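/- Let $X$ be a compact metric space with metric $d$, $f:X\to X$ continuous and $\varphi:X\to\mathbb R$ continuous. Let $\mathcal M(X)$ be the space of Borel probability measures on $X$ with the weak-* topology. For $n\ge 1$ put $S_n\varphi=\sum_{i=0}^{n-1}\varphi\circ f^i$, $d_n(x,y)=\max_{0\le i<n}d(f^ix,f^iy)$ and $\mathcal E_n(x)=\frac1n\sum_{k=0}^{n-1}\delta_{f^kx}$, and for $F\subset\mathcal M(X)$ put $X_{n,F}=\{x\in X:\mathcal E_n(x)\in F\}$. For $\varepsilon,\delta>0$, a set $E\subset X$ is $(n,\varepsilon)$-separated if $d_n(x,y)>\varepsilon$ for all distinct $x,y\in E$, and $(\delta,n,\varepsilon)$-separated if $\#\{0\le j\le n-1: d(f^jx,f^jy)>\varepsilon\}\ge\delta n$ for all distinct $x,y\in E$. Let $P(F;\varphi,n,\varepsilon)$ (respectively $P(F;\varphi,\delta,n,\varepsilon)$) be the supremum of $\sum_{x\in E}e^{S_n\varphi(x)}$ over all $(n,\varepsilon)$-separated (respectively $(\delta,n,\varepsilon)$-separated) sets $E\subset X_{n,F}$. With $\log 0=-\infty$, for $\mu\in\mathcal M(X)$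 define $$\overline{SP}_\mu(f,\varphi)=\lim_{\varepsilon\to0^+}\inf_{F}\limsup_{n\to\infty}\tfrac1n\log P(F;\varphi,n,\varepsilon),\qquad \overline{SP}'_\mu(f,\varphi)=\lim_{\varepsilon\to0^+}\lim_{\delta\to0^+}\inf_{F}\limsup_{n\to\infty}\tfrac1n\log P(F;\varphi,\delta,n,\varepsilon),$$ where $F$ runs over the neighborhoods of $\mu$ in $\mathcal M(X)$, and define $\underline{SP}_\mu(f,\varphi)$, $\underline{SP}'_\mu(f,\varphi)$ in the same way with $\liminf_{n\to\infty}$ in place of $\limsup_{n\to\infty}$ (the limits in $\varepsilon$ and $\delta$ exist in $[-\infty,+\infty]$ by monotonicity). Let $h_\mu(f)\in[0,+\infty]$ be the Kolmogorov--Sinai entropy of an $f$-invariant $\mu$. Then: 1. For every ergodic $f$-invariant $\mu\in\mathcal M(X)$, $$\underline{SP}_\mu(f,\varphi)=\overline{SP}_\mu(f,\varphi)=\underline{SP}'_\mu(f,\varphi)=\overline{SP}'_\mu(f,\varphi)=h_\mu(f)+\int\varphi\,d\mu .$$ That is, $SP_\mu(f,\varphi)$ and $SP'_\mu(f,\varphi)$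 (the common values of the lower and upper quantities) exist and equal $h_\mu(f)+\int\varphi\,d\mu$. 2. For every $f$-invariant $\mu\in\mathcal M(X)$, $$\overline{SP}_\mu(f,\varphi)\le h_\mu(f)+\int\varphi\,d\mu\quad\text{and}\quad\overline{SP}'_\mu(f,\varphi)\le h_\mu(f)+\int\varphi\,d\mu .$$ -/

import Mathlib

open Filter Topology MeasureTheory
open scoped ENNReal

namespace SepPressure

/-! ### Kolmogorov–Sinai entropy -/

section Entropy

variable {X : Type*} [MeasurableSpace X]

/-- The Shannon entropy `H_μ(ξ) = -∑ μ(A) log μ(A)` of the finite partition of `X` into the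
fibres of the labelling map `ξ`. -/
noncomputable def partitionEntropy {ι : Type*} [Fintype ι] (μ : Measure X) (ξ : X → ι) : ℝ :=
  ∑ i, Real.negMulLog (μ.real (ξ ⁻¹' {i}))

/-- The labelling map of the refined partition `⋁_{i < n} f^{-i} ξ`. -/
def iteratedPartition {ι : Type*} (f : X → X) (ξ : X → ι) (n : ℕ) (x : X) : Fin n → ι :=
  fun i => ξ (f^[i] x)

/-- The entropy `h_μ(f, ξ) = lim_n (1/n) H_μ(⋁_{i < n} f^{-i} ξ)`. For an invariant probability
measure the sequence of entropies is subadditive and nonnegative, so that this lower limit is a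
limit. -/
noncomputable def entropyOfPartition {ι : Type*} [Fintype ι]
    (f : X → X) (μ : Measure X) (ξ : X → ι) : EReal :=
  liminf (fun n : ℕ =>
    ((partitionEntropy μ (iteratedPartition f ξ n) / (n : ℝ) : ℝ) : EReal)) atTop

/-- The Kolmogorov–Sinai entropy `h_μ(f)`: the supremum of `h_μ(f, ξ)` over all finite measurable
partitions `ξ`. -/
noncomputable def entropy (f : X → X) (μ : Measure X) : EReal :=
  ⨆ (k : ℕ) (ξ : X → Fin k) (_ : Measurable ξ), entropyOfPartition f μ ξ

/-- The free energy `h_μ(f) + ∫ φ dμ`. -/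
noncomputable def freeEnergy (f : X → X) (φ : X → ℝ) (μ : Measure X) : EReal :=
  entropy f μ + ((∫ x, φ x ∂μ : ℝ) : EReal)

/-- The empirical measure `(1/n) ∑_{k < n} δ_{f^k x}`. -/
noncomputable def empiricalMeasure (f : X → X) (n : ℕ) (x : X) : Measure X :=
  (n : ℝ≥0∞)⁻¹ • ∑ k ∈ Finset.range n, Measure.dirac (f^[k] x)

/-- The set `X_{n,F}` of the points whose `n`-th empirical measure lies in `F`. -/
def empiricalSet (f : X → X) (n : ℕ) (F : Set (ProbabilityMeasure X)) : Set X :=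
  {x | ∃ ν ∈ F, (ν : Measure X) = empiricalMeasure f n x}

end Entropy

/-! ### Separated sets -/

section Separated

variable {X : Type*} [MetricSpace X]

/-- The dynamical metric `d_n(x, y) = max {d(f^i x, f^i y) : 0 ≤ i < n}`. -/
noncomputable def dynDist (f : X → X) (n : ℕ) (x y : X) : ℝ :=
  ⨆ i : Fin n, dist (f^[i] x) (f^[i] y)

/-- `(n, ε)`-separated sets. -/
def IsSeparated (f : X → X) (n : ℕ) (ε : ℝ) (E : Set X) : Prop :=
  ∀ x ∈ E, ∀ y ∈ E, x ≠ y → ε < dynDist f n x y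

/-- `(δ, n, ε)`-separated sets. -/
def IsDeltaSeparated (f : X → X) (δ : ℝ) (n : ℕ) (ε : ℝ) (A : Set X) : Prop :=
  ∀ x ∈ A, ∀ y ∈ A, x ≠ y →
    δ * n ≤ (Set.ncard {j : ℕ | j < n ∧ ε < dist (f^[j] x) (f^[j] y)} : ℝ)

lemma IsSeparated.anti {f : X → X} {n : ℕ} {ε ε' : ℝ} {E : Set X} (h : ε ≤ ε')
    (hE : IsSeparated f n ε' E) : IsSeparated f n ε E :=
  fun x hx y hy hxy => h.trans_lt (hE x hx y hy hxy)

lemma IsDeltaSeparated.anti {f : X → X} {n : ℕ} {δ δ' ε ε' : ℝ} {A : Set X}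
    (hδ : δ ≤ δ') (h : ε ≤ ε') (hA : IsDeltaSeparated f δ' n ε' A) :
    IsDeltaSeparated f δ n ε A := by
  intro x hx y hy hxy
  have h1 := hA x hx y hy hxy
  have h2 : δ * n ≤ δ' * n := by gcongr
  refine h2.trans (h1.trans ?_)
  have hfin : ({j : ℕ | j < n ∧ ε < dist (f^[j] x) (f^[j] y)}).Finite :=
    (Set.finite_lt_nat n).subset fun j hj => hj.1
  have hsub : {j : ℕ | j < n ∧ ε' < dist (f^[j] x) (f^[j] y)} ⊆
      {j : ℕ | j < n ∧ ε < dist (f^[j] x) (f^[j] y)} := fun j hj => ⟨hj.1, h.trans_lt hj.2⟩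
  exact_mod_cast Set.ncard_le_ncard hsub hfin

end Separated

/-! ### Measure theoretic pressure via separated sets -/

section Pressure

variable {X : Type*} [MetricSpace X] [MeasurableSpace X]

/-- `P(F; φ, n, ε)`, the supremum of `∑_{x ∈ E} exp (S_n φ(x))` over the `(n, ε)`-separated sets
`E ⊆ X_{n,F}`. Finite sets suffice, since subsets of separated sets are separated (and, when `X`
is compact, `f` continuous, `n ≥ 1` and `ε > 0`, all of them are finite). -/
noncomputable def sepSum (f : X → X) (φ : X → ℝ) (F : Set (ProbabilityMeasure X))
    (n : ℕ) (ε : ℝ) : ℝ≥0∞ :=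
  ⨆ (E : Finset X) (_ : (E : Set X) ⊆ empiricalSet f n F) (_ : IsSeparated f n ε (E : Set X)),
    ∑ x ∈ E, ENNReal.ofReal (Real.exp (birkhoffSum f φ n x))

/-- `P(F; φ, δ, n, ε)`, the same supremum over `(δ, n, ε)`-separated sets. -/
noncomputable def deltaSepSum (f : X → X) (φ : X → ℝ) (F : Set (ProbabilityMeasure X))
    (δ : ℝ) (n : ℕ) (ε : ℝ) : ℝ≥0∞ :=
  ⨆ (E : Finset X) (_ : (E : Set X) ⊆ empiricalSet f n F)
    (_ : IsDeltaSeparated f δ n ε (E : Set X)),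
    ∑ x ∈ E, ENNReal.ofReal (Real.exp (birkhoffSum f φ n x))

lemma sepSum_anti (f : X → X) (φ : X → ℝ) (F : Set (ProbabilityMeasure X)) (n : ℕ)
    {ε ε' : ℝ} (h : ε ≤ ε') : sepSum f φ F n ε' ≤ sepSum f φ F n ε :=
  iSup_mono fun _ => iSup_mono fun _ => iSup_mono' fun hE => ⟨hE.anti h, le_rfl⟩

lemma deltaSepSum_anti (f : X → X) (φ : X → ℝ) (F : Set (ProbabilityMeasure X)) (n : ℕ)
    {δ δ' ε ε' : ℝ} (hδ : δ ≤ δ') (h : ε ≤ ε') :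
    deltaSepSum f φ F δ' n ε' ≤ deltaSepSum f φ F δ n ε :=
  iSup_mono fun _ => iSup_mono fun _ => iSup_mono' fun hE => ⟨hE.anti hδ h, le_rfl⟩

variable [OpensMeasurableSpace X]

/-- `inf_{F ∋ ν} limsup_n (1/n) log P(F; φ, n, ε)`, the infimum being over the (weak)
neighbourhoods `F` of `ν`; here `log 0 = -∞`. -/
noncomputable def upperSPAt (f : X → X) (φ : X → ℝ) (ν : ProbabilityMeasure X) (ε : ℝ) : EReal :=
  ⨅ F ∈ 𝓝 ν, limsup (fun n : ℕ => ENNReal.log (sepSum f φ F n ε) / (n : EReal)) atTop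

/-- `inf_{F ∋ ν} liminf_n (1/n) log P(F; φ, n, ε)`. -/
noncomputable def lowerSPAt (f : X → X) (φ : X → ℝ) (ν : ProbabilityMeasure X) (ε : ℝ) : EReal :=
  ⨅ F ∈ 𝓝 ν, liminf (fun n : ℕ => ENNReal.log (sepSum f φ F n ε) / (n : EReal)) atTop

/-- `inf_{F ∋ ν} limsup_n (1/n) log P(F; φ, δ, n, ε)`. -/
noncomputable def upperDeltaSPAt (f : X → X) (φ : X → ℝ) (ν : ProbabilityMeasure X)
    (δ ε : ℝ) : EReal :=
  ⨅ F ∈ 𝓝 ν, limsup (fun n : ℕ => ENNReal.log (deltaSepSum f φ F δ n ε) / (n : EReal)) atTop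

/-- `inf_{F ∋ ν} liminf_n (1/n) log P(F; φ, δ, n, ε)`. -/
noncomputable def lowerDeltaSPAt (f : X → X) (φ : X → ℝ) (ν : ProbabilityMeasure X)
    (δ ε : ℝ) : EReal :=
  ⨅ F ∈ 𝓝 ν, liminf (fun n : ℕ => ENNReal.log (deltaSepSum f φ F δ n ε) / (n : EReal)) atTop

/-- The upper pressure: the limit as `ε → 0+` (it exists, see `tendsto_upperSP`). -/
noncomputable def upperSP (f : X → X) (φ : X → ℝ) (ν : ProbabilityMeasure X) : EReal :=
  limUnder (𝓝[>] (0 : ℝ)) fun ε => upperSPAt f φ ν ε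

/-- The lower pressure: the limit as `ε → 0+` (it exists, see `tendsto_lowerSP`). -/
noncomputable def lowerSP (f : X → X) (φ : X → ℝ) (ν : ProbabilityMeasure X) : EReal :=
  limUnder (𝓝[>] (0 : ℝ)) fun ε => lowerSPAt f φ ν ε

/-- The upper pressure over `(δ, n, ε)`-separated sets: the limit as `ε → 0+` of the limit as
`δ → 0+` (both exist, see `tendsto_upperDeltaSP`). -/
noncomputable def upperDeltaSP (f : X → X) (φ : X → ℝ) (ν : ProbabilityMeasure X) : EReal :=
  limUnder (𝓝[>] (0 : ℝ)) fun ε =>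
    limUnder (𝓝[>] (0 : ℝ)) fun δ => upperDeltaSPAt f φ ν δ ε

/-- The lower pressure over `(δ, n, ε)`-separated sets: the limit as `ε → 0+` of the limit as
`δ → 0+` (both exist, see `tendsto_lowerDeltaSP`). -/
noncomputable def lowerDeltaSP (f : X → X) (φ : X → ℝ) (ν : ProbabilityMeasure X) : EReal :=
  limUnder (𝓝[>] (0 : ℝ)) fun ε =>
    limUnder (𝓝[>] (0 : ℝ)) fun δ => lowerDeltaSPAt f φ ν δ ε

/-! The limits above exist, by monotonicity. -/

lemma log_div_mono (n : ℕ) {a b : ℝ≥0∞} (h : a ≤ b) :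
    ENNReal.log a / (n : EReal) ≤ ENNReal.log b / (n : EReal) :=
  EReal.div_le_div_right_of_nonneg (by positivity) (ENNReal.log_monotone h)

lemma upperSPAt_anti (f : X → X) (φ : X → ℝ) (ν : ProbabilityMeasure X) :
    Antitone (upperSPAt f φ ν) := fun _ _ h =>
  iInf₂_mono fun F _ => limsup_le_limsup
    (Eventually.of_forall fun n => log_div_mono n (sepSum_anti f φ F n h))

lemma lowerSPAt_anti (f : X → X) (φ : X → ℝ) (ν : ProbabilityMeasure X) :
    Antitone (lowerSPAt f φ ν) := fun _ _ h =>
  iInf₂_mono fun F _ => liminf_le_liminf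
    (Eventually.of_forall fun n => log_div_mono n (sepSum_anti f φ F n h))

lemma upperDeltaSPAt_anti (f : X → X) (φ : X → ℝ) (ν : ProbabilityMeasure X)
    {δ δ' ε ε' : ℝ} (hδ : δ ≤ δ') (h : ε ≤ ε') :
    upperDeltaSPAt f φ ν δ' ε' ≤ upperDeltaSPAt f φ ν δ ε :=
  iInf₂_mono fun F _ => limsup_le_limsup
    (Eventually.of_forall fun n => log_div_mono n (deltaSepSum_anti f φ F n hδ h))

lemma lowerDeltaSPAt_anti (f : X → X) (φ : X → ℝ) (ν : ProbabilityMeasure X)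
    {δ δ' ε ε' : ℝ} (hδ : δ ≤ δ') (h : ε ≤ ε') :
    lowerDeltaSPAt f φ ν δ' ε' ≤ lowerDeltaSPAt f φ ν δ ε :=
  iInf₂_mono fun F _ => liminf_le_liminf
    (Eventually.of_forall fun n => log_div_mono n (deltaSepSum_anti f φ F n hδ h))

lemma tendsto_limUnder_of_antitone {g : ℝ → EReal} (hg : Antitone g) :
    Tendsto g (𝓝[>] 0) (𝓝 (limUnder (𝓝[>] (0 : ℝ)) g)) :=
  tendsto_nhds_limUnder ⟨_, hg.tendsto_nhdsGT 0⟩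

lemma limUnder_anti {g : ℝ → ℝ → EReal} (hδ : ∀ ε, Antitone fun δ => g δ ε)
    (hε : ∀ δ, Antitone (g δ)) :
    Antitone fun ε => limUnder (𝓝[>] (0 : ℝ)) fun δ => g δ ε := fun a b h =>
  le_of_tendsto_of_tendsto' (tendsto_limUnder_of_antitone (hδ b))
    (tendsto_limUnder_of_antitone (hδ a)) fun δ => hε δ h

theorem tendsto_upperSP (f : X → X) (φ : X → ℝ) (ν : ProbabilityMeasure X) :
    Tendsto (fun ε => upperSPAt f φ ν ε) (𝓝[>] 0) (𝓝 (upperSP f φ ν)) :=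
  tendsto_limUnder_of_antitone (upperSPAt_anti f φ ν)

theorem tendsto_lowerSP (f : X → X) (φ : X → ℝ) (ν : ProbabilityMeasure X) :
    Tendsto (fun ε => lowerSPAt f φ ν ε) (𝓝[>] 0) (𝓝 (lowerSP f φ ν)) :=
  tendsto_limUnder_of_antitone (lowerSPAt_anti f φ ν)

theorem tendsto_upperDeltaSP (f : X → X) (φ : X → ℝ) (ν : ProbabilityMeasure X) :
    ∃ L : ℝ → EReal,
      (∀ ε, Tendsto (fun δ => upperDeltaSPAt f φ ν δ ε) (𝓝[>] 0) (𝓝 (L ε))) ∧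
      Tendsto L (𝓝[>] 0) (𝓝 (upperDeltaSP f φ ν)) :=
  ⟨_, fun _ => tendsto_limUnder_of_antitone fun _ _ h => upperDeltaSPAt_anti f φ ν h le_rfl,
    tendsto_limUnder_of_antitone (limUnder_anti
      (fun _ _ _ h => upperDeltaSPAt_anti f φ ν h le_rfl)
      (fun _ _ _ h => upperDeltaSPAt_anti f φ ν le_rfl h))⟩

theorem tendsto_lowerDeltaSP (f : X → X) (φ : X → ℝ) (ν : ProbabilityMeasure X) :
    ∃ L : ℝ → EReal,
      (∀ ε, Tendsto (fun δ => lowerDeltaSPAt f φ ν δ ε) (𝓝[>] 0) (𝓝 (L ε))) ∧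
      Tendsto L (𝓝[>] 0) (𝓝 (lowerDeltaSP f φ ν)) :=
  ⟨_, fun _ => tendsto_limUnder_of_antitone fun _ _ h => lowerDeltaSPAt_anti f φ ν h le_rfl,
    tendsto_limUnder_of_antitone (limUnder_anti
      (fun _ _ _ h => lowerDeltaSPAt_anti f φ ν h le_rfl)
      (fun _ _ _ h => lowerDeltaSPAt_anti f φ ν le_rfl h))⟩

end Pressure

end SepPressure

namespace SepPressure

/-! ### Finite combinatorics of words -/

section Words

variable {ι : Type*} [Fintype ι]

/-! Both bounds come from coding orbits by a finite partition `ξ` and counting the resulting names.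
Write `I = ∫ φ dμ`. Near `μ` the sum `S_n φ` equals `n I` up to a small multiple of `n`, so only the
exponential growth of separated sets has to be compared with the entropy.

Upper bound (`upperSPAt_le_freeEnergy`), for invariant `μ`. Take `ξ` with cells of diameter at most
`ε` and `μ`-null boundary, so that points of a separated set have distinct names. If `h_μ(f, ξ) <
b`, some conditional entropy `H_{N+1} - H_N` is below `b` (`exists_increment_lt`). Smooth the
conditional probabilities of `μ` to a positive Markov kernel `q` of memory `N`
(`exists_markov_kernel`). For empirical measures near `μ`, the average of `-log q` along the orbit
stays below `b`, so the name of such a point has `q`-weight at least `exp(-n b)`. The total weight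
of all names is at most `k^N` (`sum_prod_window_le`), which bounds the number of points by `k^N
exp(n b)`. No ergodic decomposition is needed.

Lower bound (`exists_le_lowerDeltaSPAt`), for ergodic `μ`. Take `ξ` whose entropy exceeds `b`. By
the mean ergodic theorem, outside a set of small measure the points have empirical measure near `μ`
and rarely leave a set `W` in which distinct cells are a definite distance apart. Entropy itself,
instead of the Shannon-McMillan-Breiman theorem, shows that these points carry about `exp(n b)`
names (`partitionEntropy_le_of_subset_preimage`). Points that fail to be `(δ, n, ε)`-separated have
names close in Hamming distance, and Hamming balls of small radius have subexponential size
(`exists_hamming_card_le`), so a maximal separated set is almost as numerous as the names.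

For `δ > 0` and `n ≥ 1`, `(δ, n, ε)`-separation implies `(n, ε)`-separation. All four pressures
therefore lie between the lower `δ`-pressure and the upper ordinary one, and the two bounds close
the chain. -/

lemma sum_fin_succ_arrow {N : ℕ} (g : (Fin (N + 1) → ι) → ℝ) :
    ∑ v, g v = ∑ u : Fin N → ι, ∑ a, g (Fin.snoc (α := fun _ => ι) u a) := by
  rw [← (Fin.snocEquiv fun _ : Fin (N + 1) => ι).sum_comp, Fintype.sum_prod_type_right]
  rfl

/-- Kraft inequality for a Markov kernel with memory `N`. -/
lemma sum_prod_window_le {N : ℕ} (q : (Fin (N + 1) → ι) → ℝ) (hq0 : ∀ v, 0 ≤ q v)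
    (hq : ∀ u : Fin N → ι, ∑ a, q (Fin.snoc (α := fun _ => ι) u a) ≤ 1) (t : ℕ) :
    ∑ w : Fin (N + t) → ι, ∏ i : Fin t, q (fun j => w ⟨i + j, by omega⟩) ≤
      (Fintype.card ι : ℝ) ^ N := by
  induction t with
  | zero => simp
  | succ t ih =>
    refine le_trans ?_ ih
    change ∑ w : Fin ((N + t) + 1) → ι, ∏ i : Fin (t + 1), q (fun j => w ⟨i + j, by omega⟩) ≤ _
    rw [sum_fin_succ_arrow]
    refine Finset.sum_le_sum fun u _ => ?_
    -- Only the last window meets the new letter `a`; summing that factor over `a` gives at most 1.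
    have h1 : ∀ a, ∏ i : Fin (t + 1),
        q (fun j => Fin.snoc (α := fun _ => ι) u a ⟨i + j, by omega⟩) =
        (∏ i : Fin t, q (fun j => u ⟨i + j, by omega⟩)) *
          q (Fin.snoc (α := fun _ => ι) (fun j : Fin N => u ⟨t + j, by omega⟩) a) := by
      intro a
      rw [Fin.prod_univ_castSucc]
      congr 1
      · refine Finset.prod_congr rfl fun i _ => congrArg q (funext fun j => ?_)
        have : (i : ℕ) + j < N + t := by omega
        simp [Fin.snoc, this]
      · congr 1
        funext j
        by_cases hj : (j : ℕ) < N
        · have : t + (j : ℕ) < N + t := by omega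
          simp [Fin.snoc, this, hj]
        · have : ¬ t + (j : ℕ) < N + t := by omega
          simp [Fin.snoc, this, hj]
    simp only [h1]
    rw [← Finset.mul_sum]
    exact mul_le_of_le_one_right (Finset.prod_nonneg fun i _ => hq0 _) (hq _)

/-- The number of words at normalized Hamming distance at most `θ` from a given word. -/
lemma card_hamming_mul_le [DecidableEq ι] {n : ℕ} (w₀ : Fin n → ι) {β θ : ℝ} (hβ : 0 < β)
    (hβ1 : β < 1) (S : Finset (Fin n → ι))
    (hS : ∀ w ∈ S, ((Finset.univ.filter fun i => w i ≠ w₀ i).card : ℝ) ≤ θ * n) :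
    (S.card : ℝ) * ((1 - β) ^ n * (β / Fintype.card ι) ^ (θ * n)) ≤ 1 := by
  set k : ℝ := (Fintype.card ι : ℝ)
  -- A product weight centred at `w₀`, of total mass at most 1. Each error costs a factor `β / k`,
  -- so every word of `S` has at least the claimed mass.
  let g : Fin n → ι → ℝ := fun i a => if a = w₀ i then 1 - β else β / k
  rcases n.eq_zero_or_pos with rfl | hn
  · have : S.card ≤ 1 := (Finset.card_le_univ S).trans (by simp)
    simpa using this
  have hk : 1 ≤ k := by
    have : Nonempty ι := ⟨w₀ ⟨0, hn⟩⟩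
    exact Nat.one_le_cast.2 Fintype.card_pos
  have hβk : 0 < β / k := by positivity
  have hβk1 : β / k ≤ 1 := (div_le_one (by positivity)).2 (hβ1.le.trans hk)
  have hg0 : ∀ i a, 0 ≤ g i a := fun i a => by
    simp only [g]; split_ifs <;> linarith
  have hg : ∀ i, ∑ a, g i a ≤ 1 := fun i => by
    calc ∑ a, g i a ≤ ∑ a, ((if a = w₀ i then 1 - β else 0) + β / k) := by
          refine Finset.sum_le_sum fun a _ => ?_
          simp only [g]; split_ifs <;> linarith
      _ = 1 := by
          rw [Finset.sum_add_distrib]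
          simp [k]
          have : (Fintype.card ι : ℝ) ≠ 0 := by change k ≠ 0; positivity
          field_simp
          ring
  have htot : ∑ w : Fin n → ι, ∏ i, g i (w i) ≤ 1 := by
    rw [← Fintype.prod_sum]
    exact Finset.prod_le_one (fun i _ => Finset.sum_nonneg fun a _ => hg0 i a) fun i _ => hg i
  refine le_trans ?_ htot
  rw [← nsmul_eq_mul]
  calc _ ≤ ∑ w ∈ S, ∏ i, g i (w i) := by
        refine Finset.card_nsmul_le_sum _ _ _ fun w hw => ?_
        simp only [g]
        rw [Finset.prod_ite]
        simp only [Finset.prod_const]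
        refine mul_le_mul ?_ ?_ (by positivity) (pow_nonneg (by linarith) _)
        · refine pow_le_pow_of_le_one (by linarith) (by linarith) ?_
          simpa using Finset.card_filter_le (Finset.univ : Finset (Fin n)) fun i => w i = w₀ i
        · rw [← Real.rpow_natCast]
          exact Real.rpow_le_rpow_of_exponent_ge hβk hβk1 (hS w hw)
    _ ≤ _ := Finset.sum_le_sum_of_subset_of_nonneg (Finset.subset_univ _)
        fun w _ _ => Finset.prod_nonneg fun i _ => hg0 _ _

lemma exists_hamming_card_le (ι : Type*) [Fintype ι] [DecidableEq ι] {κ : ℝ} (hκ : 0 < κ) :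
    ∃ θ : ℝ, 0 < θ ∧ ∀ (n : ℕ) (w₀ : Fin n → ι) (S : Finset (Fin n → ι)),
      (∀ w ∈ S, ((Finset.univ.filter fun i => w i ≠ w₀ i).card : ℝ) ≤ θ * n) →
        (S.card : ℝ) ≤ Real.exp (n * κ) := by
  set k : ℝ := (Fintype.card ι : ℝ)
  -- Half of `κ` pays for `(1 - β) ^ n`, the other half for the errors: the choice `θ = (κ / 2) / (l
  -- + 1)` gives `θ * l ≤ κ / 2`, and the `+ 1` avoids dividing by zero.
  set β : ℝ := 1 - Real.exp (-(κ / 2))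
  have hexp : Real.exp (-(κ / 2)) < 1 := Real.exp_lt_one_iff.2 (by linarith)
  have hβ : 0 < β := by simp only [β]; linarith
  have hβ1 : β < 1 := by simp only [β]; linarith [Real.exp_pos (-(κ / 2))]
  set l := |Real.log (β / k)|
  have hl : 0 ≤ l := abs_nonneg _
  refine ⟨κ / 2 / (l + 1), by positivity, fun n w₀ S hS => ?_⟩
  rcases n.eq_zero_or_pos with rfl | hn
  · have : S.card ≤ 1 := (Finset.card_le_univ S).trans (by simp)
    simpa using this
  have hk : 0 < k := by
    have : Nonempty ι := ⟨w₀ ⟨0, hn⟩⟩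
    exact Nat.cast_pos.2 (Fintype.card_pos (α := ι))
  have h := card_hamming_mul_le w₀ hβ hβ1 S hS
  have h1 : Real.exp (-(n * κ)) ≤ (1 - β) ^ n * (β / k) ^ (κ / 2 / (l + 1) * n) := by
    rw [Real.rpow_def_of_pos (by positivity), show 1 - β = Real.exp (-(κ / 2)) by simp [β],
      ← Real.exp_nat_mul, ← Real.exp_add, Real.exp_le_exp]
    have h2 : -l ≤ Real.log (β / k) := neg_abs_le _
    have h3 : l * (κ / 2 / (l + 1)) ≤ κ / 2 := by
      rw [mul_div_assoc', div_le_iff₀ (by positivity)]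
      nlinarith
    have h4 : -l * (κ / 2 / (l + 1) * n) ≤ Real.log (β / k) * (κ / 2 / (l + 1) * n) :=
      mul_le_mul_of_nonneg_right h2 (by positivity)
    have h5 : l * (κ / 2 / (l + 1)) * n ≤ κ / 2 * n :=
      mul_le_mul_of_nonneg_right h3 (by positivity)
    nlinarith
  have h2 : (S.card : ℝ) * Real.exp (-(n * κ)) ≤ 1 :=
    (mul_le_mul_of_nonneg_left h1 (by positivity)).trans h
  rwa [Real.exp_neg, ← div_eq_mul_inv, div_le_one (Real.exp_pos _)] at h2

end Words

/-! ### Shannon entropy of finite distributions -/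

section Shannon

variable {α : Type*} [Fintype α]

/-- Gibbs' inequality. -/
lemma sum_negMulLog_le {p q : α → ℝ} (hp : ∀ a, 0 ≤ p a) (hp1 : ∑ a, p a = 1)
    (hq : ∀ a, 0 < q a) (hq1 : ∑ a, q a ≤ 1) :
    ∑ a, Real.negMulLog (p a) ≤ ∑ a, p a * -Real.log (q a) := by
  have h : ∀ a, Real.negMulLog (p a) - p a * -Real.log (q a) ≤ q a - p a := by
    intro a
    rcases (hp a).eq_or_lt with h0 | h0
    · simp [← h0, (hq a).le]
    · have h1 := Real.log_le_sub_one_of_pos (div_pos (hq a) h0)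
      rw [Real.log_div (hq a).ne' h0.ne'] at h1
      have h2 := mul_le_mul_of_nonneg_left h1 h0.le
      have h3 : p a * (q a / p a - 1) = q a - p a := by field_simp
      rw [h3] at h2
      simp only [Real.negMulLog]
      linarith
  have := Finset.sum_le_sum fun a (_ : a ∈ Finset.univ) => h a
  simp only [Finset.sum_sub_distrib] at this
  linarith

/-- A distribution giving most of its mass to a set `S` has entropy at most about `log #S`. -/
lemma sum_negMulLog_le_log_card {p : α → ℝ} (hp : ∀ a, 0 ≤ p a) (hp1 : ∑ a, p a = 1)
    (S : Finset α) (hS : S.Nonempty) :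
    ∑ a, Real.negMulLog (p a) ≤ Real.log 2 + Real.log S.card +
      (1 - ∑ a ∈ S, p a) * Real.log (Fintype.card α) := by
  classical
  have hSc : (1 : ℝ) ≤ S.card := by exact_mod_cast hS.card_pos
  have hαc : (1 : ℝ) ≤ Fintype.card α := hSc.trans (by exact_mod_cast Finset.card_le_univ S)
  set s : ℝ := (S.card : ℝ)
  set c : ℝ := (Fintype.card α : ℝ)
  -- Comparison weights for Gibbs' inequality: half the uniform mass on `S`, and half the uniform
  -- density of the whole alphabet off `S`. The halving produces the `log 2`.
  let q : α → ℝ := fun a => if a ∈ S then (2 * s)⁻¹ else (2 * c)⁻¹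
  have hq : ∀ a, 0 < q a := fun a => by simp only [q]; split_ifs <;> positivity
  have hq1 : ∑ a, q a ≤ 1 := by
    calc ∑ a, q a ≤ ∑ a, ((if a ∈ S then (2 * s)⁻¹ else 0) + (2 * c)⁻¹) := by
          refine Finset.sum_le_sum fun a _ => ?_
          have : 0 ≤ (2 * c)⁻¹ := by positivity
          simp only [q]; split_ifs <;> linarith
      _ = s * (2 * s)⁻¹ + c * (2 * c)⁻¹ := by
          rw [Finset.sum_add_distrib]; simp [s, c]
      _ = 1 := by field_simp; norm_num
  refine (sum_negMulLog_le hp hp1 hq hq1).trans ?_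
  have hlogs : 0 ≤ Real.log s := Real.log_nonneg hSc
  calc ∑ a, p a * -Real.log (q a)
      ≤ ∑ a, (p a * (Real.log 2 + Real.log s) + (if a ∈ S then 0 else p a) * Real.log c) := by
        refine Finset.sum_le_sum fun a _ => ?_
        simp only [q]
        split_ifs
        · rw [Real.log_inv, Real.log_mul (by norm_num) (by positivity)]
          simp
        · rw [Real.log_inv, Real.log_mul (by norm_num) (by positivity)]
          nlinarith [mul_nonneg (hp a) hlogs]
    _ = _ := by
        rw [Finset.sum_add_distrib, ← Finset.sum_mul, ← Finset.sum_mul, hp1, one_mul]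
        congr 2
        rw [← hp1, ← Finset.sum_compl_add_sum S p, add_sub_cancel_right]
        simp [Finset.sum_ite, Finset.filter_not, ← Finset.compl_eq_univ_sdiff]

end Shannon

/-- A strictly positive smoothing of the conditional probabilities of the last letter given the
preceding ones, whose cross entropy with nearby distributions is below the conditional entropy. -/
lemma exists_markov_kernel {ι : Type*} [Fintype ι] {N : ℕ} (p : (Fin (N + 1) → ι) → ℝ)
    (hp : ∀ v, 0 ≤ p v) {b : ℝ}
    (hb : ∑ v, Real.negMulLog (p v) - ∑ u : Fin N → ι,
      Real.negMulLog (∑ a, p (Fin.snoc (α := fun _ => ι) u a)) < b) :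
    ∃ ρ : ℝ, 0 < ρ ∧ ∃ q : (Fin (N + 1) → ι) → ℝ, (∀ v, 0 < q v) ∧ (∀ v, q v ≤ 1) ∧
      (∀ u : Fin N → ι, ∑ a, q (Fin.snoc (α := fun _ => ι) u a) ≤ 1) ∧
      ∀ r : (Fin (N + 1) → ι) → ℝ, (∀ v, r v ≤ p v + ρ) → ∑ v, r v * -Real.log (q v) < b := by
  classical
  set k : ℝ := (Fintype.card ι : ℝ)
  set P : (Fin N → ι) → ℝ := fun u => ∑ a, p (Fin.snoc (α := fun _ => ι) u a)
  have hP : ∀ u, 0 ≤ P u := fun u => Finset.sum_nonneg fun a _ => hp _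
  -- This function of `ρ` is the cross entropy of the inflated weights `p + ρ` with their own
  -- conditional kernel. At `ρ = 0` it is the conditional entropy, so it stays below `b` for some
  -- small `ρ > 0`.
  have hcont : Continuous fun ρ : ℝ => ∑ v, Real.negMulLog (p v + ρ) -
      ∑ u, Real.negMulLog (P u + k * ρ) := by
    refine (continuous_finsetSum _ fun v _ => ?_).sub (continuous_finsetSum _ fun u _ => ?_)
    · exact Real.continuous_negMulLog.comp (by fun_prop)
    · exact Real.continuous_negMulLog.comp (by fun_prop)
  have hev : ∀ᶠ ρ in 𝓝[>] (0 : ℝ), ∑ v, Real.negMulLog (p v + ρ) -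
      ∑ u, Real.negMulLog (P u + k * ρ) < b := by
    refine nhdsWithin_le_nhds (hcont.continuousAt.eventually_lt_const ?_)
    simpa using hb
  obtain ⟨ρ, hρ, hρ0⟩ := (hev.and self_mem_nhdsWithin).exists
  have hρ0 : 0 < ρ := hρ0
  let q : (Fin (N + 1) → ι) → ℝ := fun v => (p v + ρ) / (P (Fin.init v) + k * ρ)
  have hinit : ∀ (u : Fin N → ι) (a : ι), Fin.init (Fin.snoc (α := fun _ => ι) u a) = u :=
    fun u a => Fin.init_snoc (α := fun _ => ι) a u
  have hk : ∀ v : Fin (N + 1) → ι, 1 ≤ k := fun v => by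
    have : Nonempty ι := ⟨v 0⟩
    exact Nat.one_le_cast.2 Fintype.card_pos
  have hq : ∀ v, 0 < q v := fun v => by
    have := hk v; have := hp v; have := hP (Fin.init v)
    simp only [q]; positivity
  have hqs : ∀ u : Fin N → ι, ∑ a, q (Fin.snoc (α := fun _ => ι) u a) ≤ 1 := fun u => by
    simp only [q, hinit]
    rw [← Finset.sum_div, Finset.sum_add_distrib]
    simp only [Finset.sum_const, Finset.card_univ, nsmul_eq_mul]
    exact div_self_le_one _
  have hq1 : ∀ v, q v ≤ 1 := fun v => by
    have h := hqs (Fin.init v)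
    have h2 := Finset.single_le_sum (f := fun a => q (Fin.snoc (α := fun _ => ι) (Fin.init v) a))
      (fun a _ => (hq _).le) (Finset.mem_univ (v (Fin.last N)))
    rw [show Fin.snoc (α := fun _ => ι) (Fin.init v) (v (Fin.last N)) = v from
      Fin.snoc_init_self v] at h2
    exact h2.trans h
  refine ⟨ρ, hρ0, q, hq, hq1, hqs, fun r hr => lt_of_le_of_lt ?_ hρ⟩
  -- An upper bound on `r` suffices because `-log q` is nonnegative.
  calc ∑ v, r v * -Real.log (q v) ≤ ∑ v, (p v + ρ) * -Real.log (q v) :=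
        Finset.sum_le_sum fun v _ => mul_le_mul_of_nonneg_right (hr v)
          (neg_nonneg.2 (Real.log_nonpos (hq v).le (hq1 v)))
    _ = ∑ v, (Real.negMulLog (p v + ρ) + (p v + ρ) * Real.log (P (Fin.init v) + k * ρ)) := by
        refine Finset.sum_congr rfl fun v _ => ?_
        have h1 : 0 < p v + ρ := by have := hp v; positivity
        have h2 : 0 < P (Fin.init v) + k * ρ := by
          have := hk v; have := hP (Fin.init v); positivity
        simp only [q, Real.log_div h1.ne' h2.ne', Real.negMulLog]
        ring
    _ = _ := by
        rw [Finset.sum_add_distrib, sub_eq_add_neg, ← Finset.sum_neg_distrib,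
          sum_fin_succ_arrow fun v => (p v + ρ) * Real.log (P (Fin.init v) + k * ρ)]
        congr 1
        refine Finset.sum_congr rfl fun u _ => ?_
        simp only [hinit, Real.negMulLog]
        rw [← Finset.sum_mul, Finset.sum_add_distrib]
        simp only [Finset.sum_const, Finset.card_univ, nsmul_eq_mul]
        ring

/-- Telescoping: increments that are all at least `b` would give `H m ≥ m * b`. Monotonicity of the
conditional entropies is thus not needed. -/
lemma exists_increment_lt {H : ℕ → ℝ} (h0 : H 0 = 0) {b : ℝ} {m : ℕ} (hm : H m < m * b) :
    ∃ N, H (N + 1) - H N < b := by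
  by_contra! h
  have : ∀ m : ℕ, m * b ≤ H m := fun m => by
    induction m with
    | zero => simp [h0]
    | succ m ih => push_cast; linarith [h m]
  exact absurd hm (this m).not_gt

/-! ### Empirical measures and the ergodic theorem -/

section Ergodic

variable {X : Type*} [MeasurableSpace X]

lemma isProbabilityMeasure_empiricalMeasure (f : X → X) {n : ℕ} (hn : n ≠ 0) (x : X) :
    IsProbabilityMeasure (empiricalMeasure f n x) := by
  refine ⟨?_⟩
  simp [empiricalMeasure, Measure.finsetSum_apply]
  exact ENNReal.inv_mul_cancel (by exact_mod_cast hn) (ENNReal.natCast_ne_top n)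

lemma integral_empiricalMeasure (f : X → X) (n : ℕ) (x : X) {g : X → ℝ} (hg : Measurable g) :
    ∫ y, g y ∂(empiricalMeasure f n x) = birkhoffAverage ℝ f g n x := by
  rw [empiricalMeasure, integral_smul_measure, integral_finsetSum_measure]
  · simp [birkhoffAverage, birkhoffSum, integral_dirac' _ _ hg.stronglyMeasurable]
  · intro i _
    exact integrable_dirac' hg.stronglyMeasurable (by simp)

lemma empiricalMeasure_real_apply (f : X → X) (n : ℕ) (x : X) {A : Set X}
    (hA : MeasurableSet A) :
    (empiricalMeasure f n x).real A = birkhoffAverage ℝ f (A.indicator 1) n x := by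
  rw [← integral_empiricalMeasure f n x (measurable_one.indicator hA), integral_indicator_one hA]

lemma empiricalSet_mono (f : X → X) (n : ℕ) {F F' : Set (ProbabilityMeasure X)} (h : F ⊆ F') :
    empiricalSet f n F ⊆ empiricalSet f n F' := fun _ ⟨ν, hν, h'⟩ => ⟨ν, h hν, h'⟩

lemma empiricalSet_inter (f : X → X) (n : ℕ) (F F' : Set (ProbabilityMeasure X)) :
    empiricalSet f n F ∩ empiricalSet f n F' ⊆ empiricalSet f n (F ∩ F') := by
  rintro x ⟨⟨ν, hν, h⟩, ν', hν', h'⟩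
  obtain rfl : ν = ν' := ProbabilityMeasure.toMeasure_injective (h.trans h'.symm)
  exact ⟨ν, ⟨hν, hν'⟩, h⟩

lemma compMeasurePreserving_iterate_ae {μ : Measure X} {f : X → X} (hf : MeasurePreserving f μ μ)
    (g : Lp ℝ 2 μ) (n : ℕ) :
    ((Lp.compMeasurePreservingₗᵢ ℝ f hf).toContinuousLinearMap^[n] g : X → ℝ) =ᵐ[μ]
      (g : X → ℝ) ∘ f^[n] := by
  induction n with
  | zero => rfl
  | succ n ih =>
    rw [Function.iterate_succ_apply']
    refine (Lp.coeFn_compMeasurePreserving _ hf).trans ?_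
    rw [Function.iterate_succ, ← Function.comp_assoc]
    exact hf.quasiMeasurePreserving.ae_eq_comp ih

/-- The mean ergodic theorem, in the form of convergence in probability. -/
theorem tendsto_measure_birkhoffAverage_sub_integral {μ : Measure X} [IsProbabilityMeasure μ]
    {f : X → X} (hf : Ergodic f μ) {g : X → ℝ} (hg : MemLp g 2 μ) {η : ℝ} (hη : 0 < η) :
    Tendsto (fun n => μ {x | η ≤ |birkhoffAverage ℝ f g n x - ∫ y, g y ∂μ|}) atTop (𝓝 0) := by
  have hmp := hf.toMeasurePreserving
  set U := (Lp.compMeasurePreservingₗᵢ (p := 2) (E := ℝ) ℝ f hmp).toContinuousLinearMap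
  set G : Lp ℝ 2 μ := hg.toLp g
  have hU : ‖U‖ ≤ 1 := LinearIsometry.norm_toContinuousLinearMap_le _
  have hlim := U.tendsto_birkhoffAverage_orthogonalProjection hU G
  set h : Lp ℝ 2 μ := ((U.eqLocus (1 : Lp ℝ 2 μ →L[ℝ] Lp ℝ 2 μ)).orthogonalProjectionOnto G : Lp ℝ 2 μ)
  have hh : U h = h := ((U.eqLocus (1 : Lp ℝ 2 μ →L[ℝ] Lp ℝ 2 μ)).orthogonalProjectionOnto G).2
  have hGn : ∀ n : ℕ, ((birkhoffAverage ℝ U _root_.id n G : Lp ℝ 2 μ) : X → ℝ) =ᵐ[μ]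
      birkhoffAverage ℝ f g n := by
    intro n
    have h1 : ∀ i ∈ Finset.range n, (U^[i] G : X → ℝ) =ᵐ[μ] g ∘ f^[i] := fun i _ =>
      (compMeasurePreserving_iterate_ae hmp G i).trans
        ((hmp.iterate i).quasiMeasurePreserving.ae_eq_comp hg.coeFn_toLp)
    have h2 : ∀ᵐ x ∂μ, ∀ i ∈ Finset.range n, (U^[i] G : X → ℝ) x = g (f^[i] x) := by
      rw [Filter.eventually_all_finset]; exact h1
    filter_upwards [h2, Lp.coeFn_smul (n : ℝ)⁻¹ (∑ i ∈ Finset.range n, U^[i] G),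
      Lp.coeFn_finsetSum (Finset.range n) fun i => U^[i] G] with x hx h3 h4
    simp only [birkhoffAverage, birkhoffSum, _root_.id]
    rw [h3, Pi.smul_apply, h4]
    simp [Finset.sum_apply, Finset.sum_congr rfl hx]
  -- The limit is fixed by the Koopman operator `U`, hence constant by ergodicity. The constant is
  -- found by integrating: every average has integral `∫ g`, and integration is the inner product
  -- with the function 1, so it is continuous on `L²`.
  obtain ⟨c, hc⟩ : ∃ c, (h : X → ℝ) =ᵐ[μ] Function.const X c := by
    refine hf.ae_eq_const_of_ae_eq_comp_ae (Lp.aestronglyMeasurable h) ?_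
    refine (Lp.coeFn_compMeasurePreserving h hmp).symm.trans ?_
    exact Filter.EventuallyEq.of_eq (congrArg (fun v : Lp ℝ 2 μ => (v : X → ℝ)) hh)
  have hmeas := tendstoInMeasure_of_tendsto_Lp hlim
  have hcint : c = ∫ y, g y ∂μ := by
    have h1 : ∀ v : Lp ℝ 2 μ, (∫ y, v y ∂μ) = inner ℝ (indicatorConstLp 2 MeasurableSet.univ
        (measure_ne_top μ Set.univ) (1 : ℝ)) v := fun v => by
      rw [L2.inner_indicatorConstLp_one]; simp
    have h2 : Tendsto (fun n => ∫ y, (birkhoffAverage ℝ U _root_.id n G : Lp ℝ 2 μ) y ∂μ) atTop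
        (𝓝 (∫ y, h y ∂μ)) := by
      simp only [h1]
      exact tendsto_const_nhds.inner hlim
    have h3 : ∫ y, h y ∂μ = c := by rw [integral_congr_ae hc]; simp
    rw [h3] at h2
    refine tendsto_nhds_unique h2 (tendsto_const_nhds.congr' ?_)
    filter_upwards [eventually_ne_atTop 0] with n hn
    rw [integral_congr_ae (hGn n)]
    simp only [birkhoffAverage, birkhoffSum, smul_eq_mul]
    have hint : Integrable g μ := hg.integrable (by norm_num)
    rw [integral_const_mul, integral_finsetSum]
    · have : ∀ i, ∫ y, g (f^[i] y) ∂μ = ∫ y, g y ∂μ := fun i => by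
        have hi := hmp.iterate i
        have := integral_map hi.measurable.aemeasurable (f := g)
          (by rw [hi.map_eq]; exact hg.aestronglyMeasurable)
        rw [hi.map_eq] at this
        exact this.symm
      simp only [this]
      have : (n : ℝ) ≠ 0 := by exact_mod_cast hn
      simp [this]
    · intro i _
      exact (hmp.iterate i).integrable_comp_of_integrable hint
  rw [tendstoInMeasure_iff_norm] at hmeas
  refine (hmeas η hη).congr fun n => measure_congr ?_
  filter_upwards [hGn n, hc] with x h1 h2
  change (η ≤ ‖_ - _‖) = (η ≤ |_ - _|)
  rw [h1, h2, ← hcint, Real.norm_eq_abs]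
  rfl

end Ergodic

/-- For an ergodic measure the empirical measures converge in probability to the measure. -/
theorem tendsto_measure_compl_empiricalSet {X : Type*} [TopologicalSpace X] [MeasurableSpace X]
    [OpensMeasurableSpace X] {f : X → X} {μ : ProbabilityMeasure X}
    (hf : Ergodic f (μ : Measure X)) {F : Set (ProbabilityMeasure X)} (hF : F ∈ 𝓝 μ) :
    Tendsto (fun n => (μ : Measure X) (empiricalSet f n F)ᶜ) atTop (𝓝 0) := by
  -- The sets `F` with the desired convergence form a filter. The claim becomes `L ≤ 𝓝 μ`, which can
  -- be tested on one bounded continuous function at a time.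
  let L : Filter (ProbabilityMeasure X) :=
    { sets := {F | Tendsto (fun n => (μ : Measure X) (empiricalSet f n F)ᶜ) atTop (𝓝 0)}
      univ_sets := by
        refine tendsto_const_nhds.congr' ?_
        filter_upwards [eventually_ne_atTop 0] with n hn
        have : empiricalSet f n Set.univ = Set.univ := Set.eq_univ_of_forall fun x =>
          ⟨⟨_, isProbabilityMeasure_empiricalMeasure f hn x⟩, trivial, rfl⟩
        simp [this]
      sets_of_superset := fun {F F'} h h' =>
        tendsto_of_tendsto_of_tendsto_of_le_of_le tendsto_const_nhds h (fun _ => bot_le)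
          fun n => measure_mono (Set.compl_subset_compl.2 (empiricalSet_mono f n h'))
      inter_sets := fun {F F'} h h' => by
        have h2 := Tendsto.add h h'
        rw [add_zero] at h2
        refine tendsto_of_tendsto_of_tendsto_of_le_of_le tendsto_const_nhds h2 (fun _ => bot_le)
          fun n => (measure_mono (Set.compl_subset_compl.2 (empiricalSet_inter f n F F'))).trans ?_
        rw [Set.compl_inter]
        exact measure_union_le _ _ }
  have hL : Tendsto id L (𝓝 μ) := by
    rw [ProbabilityMeasure.tendsto_iff_forall_integral_tendsto]
    intro g
    rw [Metric.tendsto_nhds]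
    intro η hη
    change Tendsto _ _ _
    have hg : Measurable g := g.continuous.measurable
    have hgL : MemLp g 2 (μ : Measure X) :=
      MemLp.of_bound hg.aestronglyMeasurable ‖g‖ (ae_of_all _ g.norm_coe_le_norm)
    refine tendsto_of_tendsto_of_tendsto_of_le_of_le' tendsto_const_nhds
      (tendsto_measure_birkhoffAverage_sub_integral hf hgL hη)
      (Eventually.of_forall fun _ => bot_le) ?_
    filter_upwards [eventually_ne_atTop 0] with n hn
    refine measure_mono fun x hx => ?_
    by_contra hx'
    refine hx ⟨⟨_, isProbabilityMeasure_empiricalMeasure f hn x⟩, ?_, rfl⟩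
    change dist (∫ y, g y ∂(empiricalMeasure f n x)) _ < η
    rw [integral_empiricalMeasure f n x hg, Real.dist_eq]
    exact not_le.1 hx'
  exact hL hF

/-! ### Partitions with null boundary -/

lemma frontier_iInter_subset {X ι : Type*} [TopologicalSpace X] [Finite ι] (A : ι → Set X) :
    frontier (⋂ i, A i) ⊆ ⋃ i, frontier (A i) := by
  rintro x ⟨h1, h2⟩
  rw [interior_iInter_of_finite, Set.mem_iInter, not_forall] at h2
  obtain ⟨i, hi⟩ := h2
  exact Set.mem_iUnion.2 ⟨i, closure_mono (Set.iInter_subset A i) h1, hi⟩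

/-- Cover `X` by finitely many balls of radius below `ε / 2` with null boundary and send each point
to the first ball containing it. The boundary of each cell lies in the union of the boundaries of
the balls. -/
lemma exists_partition_null_frontier {X : Type*} [MetricSpace X] [CompactSpace X]
    [MeasurableSpace X] [BorelSpace X] (μ : Measure X) [IsFiniteMeasure μ] {ε : ℝ} (hε : 0 < ε) :
    ∃ (k : ℕ) (ξ : X → Fin k), Measurable ξ ∧ (∀ x y, ξ x = ξ y → dist x y ≤ ε) ∧
      ∀ i, μ (frontier (ξ ⁻¹' {i})) = 0 := by
  classical
  choose r hr hr0 using fun x : X =>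
    exists_null_frontier_thickening μ {x} (show (0 : ℝ) < ε / 2 by positivity)
  simp only [Metric.thickening_singleton] at hr0
  obtain ⟨t, ht⟩ := CompactSpace.elim_nhds_subcover (fun x => Metric.ball x (r x))
    fun x => Metric.ball_mem_nhds x (hr x).1
  let c : Fin t.card → X := fun i => t.equivFin.symm i
  let U : Fin t.card → Set X := fun i => Metric.ball (c i) (r (c i))
  have hU : ∀ x, (Finset.univ.filter fun i => x ∈ U i).Nonempty := fun x => by
    have hx : x ∈ ⋃ y ∈ t, Metric.ball y (r y) := ht ▸ Set.mem_univ x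
    simp only [Set.mem_iUnion] at hx
    obtain ⟨y, hy, hxy⟩ := hx
    exact ⟨t.equivFin ⟨y, hy⟩, by simpa [U, c] using hxy⟩
  let ξ : X → Fin t.card := fun x => (Finset.univ.filter fun i => x ∈ U i).min' (hU x)
  have hmem : ∀ x, x ∈ U (ξ x) := fun x => by
    have := Finset.min'_mem _ (hU x)
    exact (Finset.mem_filter.1 this).2
  have hpre : ∀ i, ξ ⁻¹' {i} =
      ⋂ j, (if j < i then (U j)ᶜ else if j = i then U i else Set.univ) := by
    intro i
    ext x
    simp only [Set.mem_preimage, Set.mem_singleton_iff, Set.mem_iInter]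
    constructor
    · rintro rfl j
      split_ifs with h1 h2
      · intro hx
        exact absurd (Finset.min'_le _ j (Finset.mem_filter.2 ⟨Finset.mem_univ _, hx⟩)) h1.not_ge
      · exact hmem x
      · trivial
    · intro h
      refine le_antisymm (Finset.min'_le _ i (Finset.mem_filter.2 ⟨Finset.mem_univ _, ?_⟩)) ?_
      · simpa using h i
      · by_contra hlt
        have h1 := h (ξ x)
        rw [if_pos (not_le.1 hlt)] at h1
        exact h1 (hmem x)
  refine ⟨t.card, ξ, measurable_to_countable' fun i => ?_, fun x y hxy => ?_, fun i => ?_⟩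
  · rw [hpre]
    refine MeasurableSet.iInter fun j => ?_
    split_ifs
    · exact measurableSet_ball.compl
    · exact measurableSet_ball
    · exact MeasurableSet.univ
  · have h1 := hmem x
    have h2 := hmem y
    rw [← hxy] at h2
    have h3 := (hr (c (ξ x))).2
    have := dist_triangle_right x y (c (ξ x))
    simp only [U, Metric.mem_ball] at h1 h2
    linarith
  · rw [hpre]
    refine measure_mono_null (frontier_iInter_subset _) (measure_iUnion_null fun j => ?_)
    split_ifs
    · rw [frontier_compl]; exact hr0 _
    · exact hr0 _
    · simp

/-! ### Names of orbits and frequencies of words -/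

section IteratedPartition

variable {X : Type*} {k : ℕ}

lemma iteratedPartition_preimage (f : X → X) (ξ : X → Fin k) (n : ℕ) (v : Fin n → Fin k) :
    iteratedPartition f ξ n ⁻¹' {v} = ⋂ i : Fin n, f^[i] ⁻¹' (ξ ⁻¹' {v i}) := by
  ext x
  simp [iteratedPartition, funext_iff]

variable [MeasurableSpace X]

lemma measurable_iteratedPartition {f : X → X} (hf : Measurable f) {ξ : X → Fin k}
    (hξ : Measurable ξ) (n : ℕ) : Measurable (iteratedPartition f ξ n) :=
  measurable_pi_lambda _ fun i => hξ.comp (hf.iterate i)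

/-- The boundary of a cylinder lies in preimages of boundaries of cells, which are null by
invariance. This makes the masses of cylinders continuous at `μ` in the weak topology. -/
lemma null_frontier_iteratedPartition [TopologicalSpace X] {μ : Measure X} {f : X → X}
    (hf : Continuous f) (hμ : MeasurePreserving f μ μ) {ξ : X → Fin k}
    (hξ : ∀ i, μ (frontier (ξ ⁻¹' {i})) = 0) (n : ℕ) (v : Fin n → Fin k) :
    μ (frontier (iteratedPartition f ξ n ⁻¹' {v})) = 0 := by
  rw [iteratedPartition_preimage]
  refine measure_mono_null (frontier_iInter_subset _) (measure_iUnion_null fun i => ?_)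
  exact measure_mono_null ((hf.iterate i).frontier_preimage_subset _)
    ((hμ.iterate i).quasiMeasurePreserving.preimage_null (hξ _))

lemma sum_measureReal_snoc {μ : Measure X} [IsFiniteMeasure μ] {f : X → X} (hf : Measurable f)
    {ξ : X → Fin k} (hξ : Measurable ξ) (n : ℕ) (u : Fin n → Fin k) :
    ∑ a, μ.real (iteratedPartition f ξ (n + 1) ⁻¹' {Fin.snoc (α := fun _ => Fin k) u a}) =
      μ.real (iteratedPartition f ξ n ⁻¹' {u}) := by
  rw [← measureReal_biUnion_finset]
  · congr 1
    ext x
    simp only [Finset.mem_univ, Set.iUnion_true, Set.mem_iUnion, Set.mem_preimage,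
      Set.mem_singleton_iff]
    constructor
    · rintro ⟨a, ha⟩
      have := congrArg (fun v : Fin (n + 1) → Fin k => fun i : Fin n => v i.castSucc) ha
      simp only [Fin.snoc_castSucc] at this
      exact this
    · rintro rfl
      exact ⟨ξ (f^[n] x), (Fin.snoc_init_self (α := fun _ => Fin k)
        (iteratedPartition f ξ (n + 1) x)).symm⟩
  · intro a _ b _ hab
    refine Set.disjoint_left.2 fun x hx hy => hab ?_
    have h : Fin.snoc (α := fun _ => Fin k) u a = Fin.snoc (α := fun _ => Fin k) u b :=
      (Set.mem_singleton_iff.1 hx).symm.trans (Set.mem_singleton_iff.1 hy)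
    simpa using congrFun h (Fin.last n)
  · exact fun a _ => measurable_iteratedPartition hf hξ _ (measurableSet_singleton _)

/-- Expresses orbit sums of a function of the local word through frequencies of cylinders, the
quantities that a neighbourhood of `μ` controls. -/
lemma birkhoffSum_comp_iteratedPartition {f : X → X} (hf : Measurable f) {ξ : X → Fin k}
    (hξ : Measurable ξ) {m : ℕ} (G : (Fin m → Fin k) → ℝ) (n : ℕ) (x : X) :
    ∑ i ∈ Finset.range n, G (iteratedPartition f ξ m (f^[i] x)) =
      n * ∑ v, (empiricalMeasure f n x).real (iteratedPartition f ξ m ⁻¹' {v}) * G v := by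
  rcases eq_or_ne n 0 with rfl | hn
  · simp
  have hn : (n : ℝ) ≠ 0 := by exact_mod_cast hn
  have h : ∀ v, (empiricalMeasure f n x).real (iteratedPartition f ξ m ⁻¹' {v}) =
      (n : ℝ)⁻¹ * ∑ i ∈ Finset.range n, if iteratedPartition f ξ m (f^[i] x) = v then 1 else 0 := by
    intro v
    rw [empiricalMeasure_real_apply f n x
      (measurable_iteratedPartition hf hξ m (measurableSet_singleton v))]
    refine congrArg _ (Finset.sum_congr rfl fun i _ => ?_)
    by_cases h : iteratedPartition f ξ m (f^[i] x) = v <;> simp [h]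
  simp only [h, Finset.mul_sum, Finset.sum_mul]
  rw [Finset.sum_comm]
  refine Finset.sum_congr rfl fun i _ => ?_
  simp [hn]

end IteratedPartition

/-! ### The upper bound -/

lemma entropyOfPartition_le_entropy {X : Type*} [MeasurableSpace X] (f : X → X) (μ : Measure X)
    {k : ℕ} {ξ : X → Fin k} (hξ : Measurable ξ) : entropyOfPartition f μ ξ ≤ entropy f μ := by
  unfold entropy
  exact le_iSup_of_le k (le_iSup₂_of_le ξ hξ le_rfl)

lemma entropy_lt_of_freeEnergy_lt {X : Type*} [MeasurableSpace X] {f : X → X} {φ : X → ℝ} {μ : Measure X} {c : ℝ}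
    (h : freeEnergy f φ μ < c) : entropy f μ < ((c - ∫ x, φ x ∂μ : ℝ) : EReal) := by
  by_contra! hle
  refine h.not_ge ?_
  have := add_le_add_left hle ((∫ x, φ x ∂μ : ℝ) : EReal)
  rwa [← EReal.coe_add, sub_add_cancel] at this

section Upper

variable {X : Type*} [MetricSpace X]

lemma IsSeparated.injOn_iteratedPartition {f : X → X} {k n : ℕ} {ε : ℝ} (hε : 0 ≤ ε) {E : Set X}
    (hE : IsSeparated f n ε E) {ξ : X → Fin k} (hξ : ∀ x y, ξ x = ξ y → dist x y ≤ ε) :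
    Set.InjOn (iteratedPartition f ξ n) E := by
  intro x hx y hy hxy
  by_contra hne
  -- Equal names keep the two orbits within `ε` at all times; `0 ≤ ε` covers the empty supremum at
  -- `n = 0`.
  exact (hE x hx y hy hne).not_ge (Real.iSup_le (fun i => hξ _ _ (congrFun hxy i)) hε)

variable [MeasurableSpace X]

/-- The names of the points of `E` are distinct, and each has Kraft weight at least `exp(-(N + t)
b)`, while all words together weigh at most `k ^ N`. -/
lemma IsSeparated.card_mul_exp_le {f : X → X} (hf : Measurable f) {k N t : ℕ} {ε b : ℝ}
    (hε : 0 ≤ ε) {ξ : X → Fin k} (hξm : Measurable ξ) (hξ : ∀ x y, ξ x = ξ y → dist x y ≤ ε)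
    (q : (Fin (N + 1) → Fin k) → ℝ) (hq0 : ∀ v, 0 < q v) (hq1 : ∀ v, q v ≤ 1)
    (hq : ∀ u : Fin N → Fin k, ∑ a, q (Fin.snoc (α := fun _ => Fin k) u a) ≤ 1)
    (E : Finset X) (hE : IsSeparated f (N + t) ε (E : Set X))
    (hb : ∀ x ∈ E, ∑ v, (empiricalMeasure f (N + t) x).real
      (iteratedPartition f ξ (N + 1) ⁻¹' {v}) * -Real.log (q v) ≤ b) :
    (E.card : ℝ) * Real.exp (-((N + t : ℕ) * b)) ≤ (k : ℝ) ^ N := by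
  classical
  have hinj := hE.injOn_iteratedPartition hε hξ
  have hKraft := sum_prod_window_le q (fun v => (hq0 v).le) hq t
  rw [Fintype.card_fin] at hKraft
  refine le_trans ?_ hKraft
  refine le_trans ?_ (Finset.sum_le_sum_of_subset_of_nonneg
    (Finset.subset_univ (E.image (iteratedPartition f ξ (N + t))))
    fun w _ _ => Finset.prod_nonneg fun i _ => (hq0 _).le)
  rw [Finset.sum_image hinj, ← nsmul_eq_mul]
  refine Finset.card_nsmul_le_sum _ _ _ fun x hx => ?_
  have h1 : ∀ i : Fin t, q (fun j : Fin (N + 1) =>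
      iteratedPartition f ξ (N + t) x ⟨i + j, by omega⟩) =
      Real.exp (-(-Real.log (q (iteratedPartition f ξ (N + 1) (f^[i] x))))) := fun i => by
    rw [neg_neg, Real.exp_log (hq0 _)]
    congr 1
    funext j
    simp only [iteratedPartition]
    rw [← Function.iterate_add_apply, add_comm]
  simp only [h1]
  rw [← Real.exp_sum, Real.exp_le_exp, Finset.sum_neg_distrib, neg_le_neg_iff,
    Fin.sum_univ_eq_sum_range
      (fun i => -Real.log (q (iteratedPartition f ξ (N + 1) (f^[i] x)))) t]
  -- The name contains `t` full windows but the empirical measure averages over `N + t` starting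
  -- times; the extra terms are nonnegative since `q ≤ 1`.
  calc _ ≤ ∑ i ∈ Finset.range (N + t), -Real.log (q (iteratedPartition f ξ (N + 1) (f^[i] x))) :=
        Finset.sum_le_sum_of_subset_of_nonneg (Finset.range_mono (by omega)) fun i _ _ =>
          neg_nonneg.2 (Real.log_nonpos (hq0 _).le (hq1 _))
    _ = _ := birkhoffSum_comp_iteratedPartition hf hξm (fun v => -Real.log (q v)) (N + t) x
    _ ≤ _ := mul_le_mul_of_nonneg_left (hb x hx) (by positivity)

lemma log_div_le {a : ℝ≥0∞} {n : ℕ} (hn : n ≠ 0) {c : ℝ}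
    (h : a ≤ ENNReal.ofReal (Real.exp (n * c))) : ENNReal.log a / (n : EReal) ≤ (c : EReal) := by
  rw [EReal.div_le_iff_le_mul (by exact_mod_cast Nat.pos_of_ne_zero hn) (EReal.natCast_ne_top n)]
  refine (ENNReal.log_monotone h).trans ?_
  rw [ENNReal.log_ofReal_of_pos (Real.exp_pos _), Real.log_exp]
  exact_mod_cast le_rfl

lemma le_log_div {a : ℝ≥0∞} {n : ℕ} (hn : n ≠ 0) {c : ℝ}
    (h : ENNReal.ofReal (Real.exp (n * c)) ≤ a) : (c : EReal) ≤ ENNReal.log a / (n : EReal) := by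
  rw [EReal.le_div_iff_mul_le (by exact_mod_cast Nat.pos_of_ne_zero hn) (EReal.natCast_ne_top n)]
  refine le_trans ?_ (ENNReal.log_monotone h)
  rw [ENNReal.log_ofReal_of_pos (Real.exp_pos _), Real.log_exp, mul_comm]
  exact_mod_cast le_rfl

variable [BorelSpace X]

/-- The measures whose integral of `φ` is close to that of `μ` form a neighbourhood of `μ`. -/
lemma setOf_abs_integral_sub_lt_mem_nhds [CompactSpace X] {φ : X → ℝ} (hφ : Continuous φ)
    (μ : ProbabilityMeasure X) {η : ℝ} (hη : 0 < η) :
    {ν : ProbabilityMeasure X | |∫ x, φ x ∂(ν : Measure X) - ∫ x, φ x ∂(μ : Measure X)| < η} ∈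
      𝓝 μ := by
  have h := ProbabilityMeasure.tendsto_iff_forall_integral_tendsto.1
    (tendsto_id (x := 𝓝 μ)) (BoundedContinuousFunction.mkOfCompact ⟨φ, hφ⟩)
  exact (Metric.tendsto_nhds.1 h) η hη

lemma birkhoffSum_eq_of_mem {f : X → X} {φ : X → ℝ} (hφ : Continuous φ) {n : ℕ} (hn : n ≠ 0)
    {x : X} {ν : ProbabilityMeasure X} (h : (ν : Measure X) = empiricalMeasure f n x) :
    birkhoffSum f φ n x = n * ∫ y, φ y ∂(ν : Measure X) := by
  rw [h, integral_empiricalMeasure f n x hφ.measurable, birkhoffAverage, smul_eq_mul,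
    mul_inv_cancel_left₀ (by exact_mod_cast hn)]

lemma upperSPAt_le_freeEnergy [CompactSpace X] {f : X → X} (hf : Continuous f) {φ : X → ℝ}
    (hφ : Continuous φ) {μ : ProbabilityMeasure X}
    (hμ : MeasurePreserving f (μ : Measure X) (μ : Measure X)) {ε : ℝ} (hε : 0 < ε) :
    upperSPAt f φ μ ε ≤ freeEnergy f φ (μ : Measure X) := by
  refine EReal.le_of_forall_lt_iff_le.1 fun c hc => ?_
  set I := ∫ x, φ x ∂(μ : Measure X)
  obtain ⟨b, hb1, hb2⟩ := EReal.lt_iff_exists_real_btwn.1 (entropy_lt_of_freeEnergy_lt hc)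
  have hb2 : b < c - I := by exact_mod_cast hb2
  obtain ⟨k, ξ, hξm, hξ, hξ0⟩ := exists_partition_null_frontier (μ : Measure X) hε
  have hent : entropyOfPartition f (μ : Measure X) ξ < b :=
    (entropyOfPartition_le_entropy f _ hξm).trans_lt hb1
  obtain ⟨m, hm, hm0⟩ := ((frequently_lt_of_liminf_lt (h := hent)).and_eventually
    (eventually_ne_atTop 0)).exists
  have hm1 : (0 : ℝ) < m := by exact_mod_cast Nat.pos_of_ne_zero hm0
  have hm : partitionEntropy (μ : Measure X) (iteratedPartition f ξ m) < m * b := by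
    rw [mul_comm, ← div_lt_iff₀ hm1]
    exact_mod_cast hm
  obtain ⟨N, hN⟩ := exists_increment_lt
    (H := fun m => partitionEntropy (μ : Measure X) (iteratedPartition f ξ m))
    (by simp [partitionEntropy, Set.eq_univ_of_forall, iteratedPartition_preimage]) hm
  obtain ⟨ρ, hρ, q, hq0, hq1, hq, hqb⟩ := exists_markov_kernel
    (fun v => (μ : Measure X).real (iteratedPartition f ξ (N + 1) ⁻¹' {v}))
    (fun v => measureReal_nonneg) (b := b) (by
      simp only [sum_measureReal_snoc hf.measurable hξm]
      exact hN)
  -- Since `c = b + I + 2 * η`, one `η` absorbs the variation of `∫ φ` on `F` and the other the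
  -- constant `k ^ N`.
  set η := (c - I - b) / 2
  have hη : 0 < η := by simp only [η]; linarith
  let F : Set (ProbabilityMeasure X) :=
    {ν | ∀ v, (ν : Measure X).real (iteratedPartition f ξ (N + 1) ⁻¹' {v}) <
      (μ : Measure X).real (iteratedPartition f ξ (N + 1) ⁻¹' {v}) + ρ} ∩
    {ν | |∫ x, φ x ∂(ν : Measure X) - I| < η}
  have hF : F ∈ 𝓝 μ := by
    refine inter_mem (eventually_all.2 fun v => ?_) (setOf_abs_integral_sub_lt_mem_nhds hφ μ hη)
    have h := ProbabilityMeasure.tendsto_measure_of_null_frontier_of_tendsto'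
      (tendsto_id (x := 𝓝 μ)) (null_frontier_iteratedPartition hf hμ hξ0 (N + 1) v)
    have h2 := (ENNReal.tendsto_toReal (measure_ne_top _ _)).comp h
    exact h2.eventually_lt_const (by simpa [Measure.real] using hρ)
  refine (iInf₂_le F hF).trans (limsup_le_of_le (h := ?_))
  have hlarge : ∀ᶠ n : ℕ in atTop, (k : ℝ) ^ N ≤ Real.exp (n * η) := by
    have : Tendsto (fun n : ℕ => Real.exp (n * η)) atTop atTop :=
      Real.tendsto_exp_atTop.comp (tendsto_natCast_atTop_atTop.atTop_mul_const hη)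
    exact this.eventually_ge_atTop _
  filter_upwards [hlarge, eventually_ge_atTop N, eventually_ne_atTop 0] with n hn hnN hn0
  refine log_div_le hn0 (iSup_le fun E => iSup_le fun hEF => iSup_le fun hE => ?_)
  rw [← ENNReal.ofReal_sum_of_nonneg fun _ _ => (Real.exp_pos _).le]
  refine ENNReal.ofReal_le_ofReal ?_
  obtain ⟨t, rfl⟩ := Nat.exists_eq_add_of_le hnN
  have hcard := hE.card_mul_exp_le hf.measurable hε.le hξm hξ q hq0 hq1 hq E (b := b)
    fun x hx => by
      obtain ⟨ν, ⟨hν, -⟩, hνx⟩ := hEF hx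
      rw [← hνx]
      exact (hqb _ fun v => (hν v).le).le
  have hsum : ∀ x ∈ E, Real.exp (birkhoffSum f φ (N + t) x) ≤
      Real.exp ((N + t : ℕ) * (I + η)) := fun x hx => by
    obtain ⟨ν, ⟨-, hν⟩, hνx⟩ := hEF hx
    rw [birkhoffSum_eq_of_mem hφ hn0 hνx, Real.exp_le_exp]
    refine mul_le_mul_of_nonneg_left ?_ (by positivity)
    have := (abs_lt.1 (Set.mem_ofPred_eq ▸ hν)).2
    linarith
  calc _ ≤ E.card • Real.exp ((N + t : ℕ) * (I + η)) := Finset.sum_le_card_nsmul _ _ _ hsum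
    _ = (E.card * Real.exp (-((N + t : ℕ) * b))) * Real.exp ((N + t : ℕ) * (b + I + η)) := by
        rw [nsmul_eq_mul, mul_assoc, ← Real.exp_add]
        congr 2
        ring
    _ ≤ Real.exp ((N + t : ℕ) * η) * Real.exp ((N + t : ℕ) * (b + I + η)) :=
        mul_le_mul_of_nonneg_right (hcard.trans hn) (Real.exp_pos _).le
    _ = _ := by
        rw [← Real.exp_add]
        congr 1
        simp only [η]
        ring

end Upper

/-! ### The lower bound -/

section Lower

/-- The entropy of the `n`-fold refinement is controlled by the number of names occurring in a set
of nearly full measure. -/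
lemma partitionEntropy_le_of_subset_preimage {X : Type*} [MeasurableSpace X] {μ : Measure X}
    [IsProbabilityMeasure μ] {f : X → X} (hf : Measurable f) {k : ℕ} {ξ : X → Fin k}
    (hξ : Measurable ξ) (n : ℕ) {G : Set X} {S : Finset (Fin n → Fin k)} (hS : S.Nonempty)
    (hG : G ⊆ iteratedPartition f ξ n ⁻¹' S) :
    partitionEntropy μ (iteratedPartition f ξ n) ≤
      Real.log 2 + Real.log S.card + μ.real Gᶜ * (n * Real.log k) := by
  have hm := measurable_iteratedPartition hf hξ n
  have hsum : ∀ T : Finset (Fin n → Fin k), ∑ v ∈ T, μ.real (iteratedPartition f ξ n ⁻¹' {v}) =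
      μ.real (iteratedPartition f ξ n ⁻¹' T) := fun T =>
    sum_measureReal_preimage_singleton T fun v _ => hm (measurableSet_singleton v)
  have h := sum_negMulLog_le_log_card
    (p := fun v => μ.real (iteratedPartition f ξ n ⁻¹' {v})) (fun v => measureReal_nonneg)
    (by rw [hsum]; simp) S hS
  refine h.trans (add_le_add_right ?_ _)
  rw [hsum, Fintype.card_fun, Fintype.card_fin, Fintype.card_fin, Nat.cast_pow, Real.log_pow,
    ← probReal_compl_eq_one_sub (hm S.measurableSet)]
  refine mul_le_mul_of_nonneg_right (measureReal_mono (Set.compl_subset_compl.2 hG)) ?_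
  exact mul_nonneg (Nat.cast_nonneg n) (Real.log_natCast_nonneg k)

variable {X : Type*} [MetricSpace X]

/-- Up to small measure the cells of a partition can be shrunk to uniformly separated sets. -/
lemma exists_separated_cells [CompactSpace X] [MeasurableSpace X] [BorelSpace X] (μ : Measure X)
    [IsFiniteMeasure μ] {k : ℕ} {ξ : X → Fin k} (hξ : Measurable ξ) {γ : ℝ} (hγ : 0 < γ) :
    ∃ W : Set X, MeasurableSet W ∧ μ.real Wᶜ ≤ γ ∧ ∃ ε : ℝ, 0 < ε ∧
      ∀ x ∈ W, ∀ y ∈ W, ξ x ≠ ξ y → ε < dist x y := by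
  have hcell : ∀ i, MeasurableSet (ξ ⁻¹' {i}) := fun i => hξ (measurableSet_singleton i)
  -- Each of the `k` cells loses at most `γ / (k + 1)`; the `+ 1` covers `k = 0`.
  have hγk : ENNReal.ofReal (γ / (k + 1)) ≠ 0 := by
    rw [Ne, ENNReal.ofReal_eq_zero, not_le]; positivity
  choose K hKs hKc hKμ using fun i =>
    (hcell i).exists_isClosed_sdiff_lt (measure_ne_top μ _) hγk
  have hWc : (⋃ i, K i)ᶜ ⊆ ⋃ i, (ξ ⁻¹' {i} \ K i) := fun x hx => by
    simp only [Set.mem_compl_iff, Set.mem_iUnion, not_exists] at hx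
    exact Set.mem_iUnion.2 ⟨ξ x, rfl, hx _⟩
  have hsep : ∀ᶠ ε in 𝓝[>] (0 : ℝ), ∀ i j, i ≠ j → ∀ x ∈ K i, ∀ y ∈ K j, ε < dist x y := by
    refine eventually_all.2 fun i => eventually_all.2 fun j => ?_
    by_cases hij : i = j
    · simp [hij]
    have hdisj : Disjoint (K i) (K j) := Set.disjoint_left.2 fun x hx hy =>
      hij ((hKs i hx : ξ x = i).symm.trans (hKs j hy))
    obtain ⟨r, hr, h⟩ := Metric.exists_pos_forall_lt_edist (hKc i).isCompact (hKc j) hdisj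
    filter_upwards [nhdsWithin_le_nhds (Iio_mem_nhds (show (0 : ℝ) < r from hr))] with ε hε _ x hx
      y hy
    have h2 := h x hx y hy
    rw [edist_nndist, ENNReal.coe_lt_coe] at h2
    exact lt_trans hε (by exact_mod_cast h2)
  obtain ⟨ε, hε, hε0⟩ := (hsep.and self_mem_nhdsWithin).exists
  refine ⟨⋃ i, K i, MeasurableSet.iUnion fun i => (hKc i).measurableSet, ?_, ε, hε0, ?_⟩
  · refine ENNReal.toReal_le_of_le_ofReal hγ.le ?_
    calc μ (⋃ i, K i)ᶜ ≤ ∑ i, μ (ξ ⁻¹' {i} \ K i) :=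
          (measure_mono hWc).trans (measure_iUnion_fintype_le _ _)
      _ ≤ ∑ _i : Fin k, ENNReal.ofReal (γ / (k + 1)) := Finset.sum_le_sum fun i _ => (hKμ i).le
      _ = ENNReal.ofReal (k * (γ / (k + 1))) := by
          rw [ENNReal.ofReal_mul (Nat.cast_nonneg k)]; simp
      _ ≤ ENNReal.ofReal γ := by
          refine ENNReal.ofReal_le_ofReal ?_
          rw [mul_div_assoc', div_le_iff₀ (by positivity)]
          nlinarith
  · intro x hx y hy hxy
    obtain ⟨i, hi⟩ := Set.mem_iUnion.1 hx
    obtain ⟨j, hj⟩ := Set.mem_iUnion.1 hy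
    refine hε i j (fun hij => hxy ?_) x hi y hj
    exact (hKs i hi : ξ x = i).trans (hij.trans (hKs j hj : ξ y = j).symm)

/-- Every finite set contains a `(δ, n, ε)`-separated subset that is maximal, hence spanning. -/
lemma exists_maximal_isDeltaSeparated (f : X → X) (δ : ℝ) (n : ℕ) (ε : ℝ) (R : Finset X) :
    ∃ E ⊆ R, IsDeltaSeparated f δ n ε (E : Set X) ∧ ∀ x ∈ R, ∃ y ∈ E, x = y ∨
      (Set.ncard {j : ℕ | j < n ∧ ε < dist (f^[j] x) (f^[j] y)} : ℝ) < δ * n := by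
  classical
  obtain ⟨E, hE, hmax⟩ := Finset.exists_max_image
    (R.powerset.filter fun E : Finset X => IsDeltaSeparated f δ n ε (E : Set X)) Finset.card
    ⟨∅, by simp [IsDeltaSeparated]⟩
  rw [Finset.mem_filter, Finset.mem_powerset] at hE
  refine ⟨E, hE.1, hE.2, fun x hx => ?_⟩
  by_contra! h
  have hxE : x ∉ E := fun hxE => (h x hxE).1 rfl
  have hins : IsDeltaSeparated f δ n ε ((insert x E : Finset X) : Set X) := by
    intro y hy z hz hyz
    rw [Finset.mem_coe, Finset.mem_insert] at hy hz
    rcases hy with rfl | hy <;> rcases hz with rfl | hz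
    · exact absurd rfl hyz
    · exact (h z hz).2
    · simpa only [dist_comm] using (h y hy).2
    · exact hE.2 y hy z hz hyz
  have := hmax (insert x E) (Finset.mem_filter.2
    ⟨Finset.mem_powerset.2 (Finset.insert_subset hx hE.1), hins⟩)
  rw [Finset.card_insert_of_notMem hxE] at this
  omega

/-- If the names differ at a time, then one of the two orbits is outside `W`, or both are inside and
more than `ε` apart. The three possibilities contribute `2γ + 2γ + γ = 5γ`. -/
lemma card_hamming_le_of_mem_of_ncard_lt {f : X → X} {k n : ℕ} {ξ : X → Fin k} {W : Set X}
    {ε γ : ℝ} (hW : ∀ x ∈ W, ∀ y ∈ W, ξ x ≠ ξ y → ε < dist x y) (hn : n ≠ 0) {x y : X}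
    (hx : birkhoffAverage ℝ f (Wᶜ.indicator 1) n x < 2 * γ)
    (hy : birkhoffAverage ℝ f (Wᶜ.indicator 1) n y < 2 * γ)
    (hxy : (Set.ncard {j : ℕ | j < n ∧ ε < dist (f^[j] x) (f^[j] y)} : ℝ) < γ * n) :
    ((Finset.univ.filter fun i => iteratedPartition f ξ n x i ≠ iteratedPartition f ξ n y i).card :
      ℝ) ≤ 5 * γ * n := by
  classical
  have hn' : (0 : ℝ) < n := by exact_mod_cast Nat.pos_of_ne_zero hn
  have hcount : ∀ z, birkhoffAverage ℝ f (Wᶜ.indicator 1) n z < 2 * γ →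
      (((Finset.range n).filter fun i => f^[i] z ∉ W).card : ℝ) ≤ 2 * γ * n := by
    intro z hz
    have h : (((Finset.range n).filter fun i => f^[i] z ∉ W).card : ℝ) =
        birkhoffSum f (Wᶜ.indicator 1) n z := by
      rw [Finset.card_filter, Nat.cast_sum, birkhoffSum]
      refine Finset.sum_congr rfl fun i _ => ?_
      by_cases h : f^[i] z ∈ W <;> simp [h]
    rw [birkhoffAverage, ← h, smul_eq_mul, inv_mul_lt_iff₀ hn'] at hz
    linarith
  have hd : Set.ncard {j : ℕ | j < n ∧ ε < dist (f^[j] x) (f^[j] y)} =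
      ((Finset.range n).filter fun i => ε < dist (f^[i] x) (f^[i] y)).card := by
    rw [← Set.ncard_coe_finset]
    simp
  rw [hd] at hxy
  have hsub : ((Finset.univ : Finset (Fin n)).filter fun i =>
      iteratedPartition f ξ n x i ≠ iteratedPartition f ξ n y i).map Fin.valEmbedding ⊆
      (((Finset.range n).filter fun i => f^[i] x ∉ W) ∪
        ((Finset.range n).filter fun i => f^[i] y ∉ W)) ∪
        ((Finset.range n).filter fun i => ε < dist (f^[i] x) (f^[i] y)) := by
    intro j hj
    simp only [Finset.mem_map, Finset.mem_filter, Finset.mem_univ, true_and,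
      Fin.valEmbedding_apply] at hj
    obtain ⟨i, hi, rfl⟩ := hj
    simp only [Finset.mem_union, Finset.mem_filter, Finset.mem_range, i.2, true_and]
    by_contra! hcon
    exact absurd (hW _ hcon.1.1 _ hcon.1.2 hi) hcon.2.not_gt
  have hcard := (Finset.card_le_card hsub).trans
    ((Finset.card_union_le _ _).trans (Nat.add_le_add_right (Finset.card_union_le _ _) _))
  rw [Finset.card_map] at hcard
  have hcard' : ((Finset.univ.filter fun i =>
      iteratedPartition f ξ n x i ≠ iteratedPartition f ξ n y i).card : ℝ) ≤
      ((Finset.range n).filter fun i => f^[i] x ∉ W).card +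
      ((Finset.range n).filter fun i => f^[i] y ∉ W).card +
      ((Finset.range n).filter fun i => ε < dist (f^[i] x) (f^[i] y)).card := by
    exact_mod_cast hcard
  linarith [hcount x hx, hcount y hy]

/-- A set whose points rarely visit the complement of the separated cells contains large
`(γ, n, ε)`-separated sets. -/
lemma exists_isDeltaSeparated_card_ge {f : X → X} {k n : ℕ} {ξ : X → Fin k} {W : Set X}
    {ε γ κ : ℝ} (hγ : 0 < γ) (hW : ∀ x ∈ W, ∀ y ∈ W, ξ x ≠ ξ y → ε < dist x y) (hn : n ≠ 0)
    (hκ : ∀ (w₀ : Fin n → Fin k) (S : Finset (Fin n → Fin k)),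
      (∀ w ∈ S, ((Finset.univ.filter fun i => w i ≠ w₀ i).card : ℝ) ≤ 5 * γ * n) →
        (S.card : ℝ) ≤ Real.exp (n * κ))
    {G : Set X} (hG : ∀ x ∈ G, birkhoffAverage ℝ f (Wᶜ.indicator 1) n x < 2 * γ) :
    ∃ S : Finset (Fin n → Fin k), G ⊆ iteratedPartition f ξ n ⁻¹' S ∧
      ∃ E : Finset X, (E : Set X) ⊆ G ∧ IsDeltaSeparated f γ n ε (E : Set X) ∧
        (S.card : ℝ) ≤ E.card * Real.exp (n * κ) := by
  classical
  set π := iteratedPartition f ξ n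
  have hn' : (0 : ℝ) < n := by exact_mod_cast Nat.pos_of_ne_zero hn
  -- One representative in `G` for each name. A maximal separated subset of representatives then
  -- covers all names by Hamming balls of size at most `exp(n κ)`.
  obtain ⟨R', hR'G, hbij⟩ := Set.exists_subset_bijOn G π
  have hfin : R'.Finite := Set.Finite.of_finite_image (Set.toFinite _) hbij.injOn
  lift R' to Finset X using hfin with R
  obtain ⟨E, hER, hE, hspan⟩ := exists_maximal_isDeltaSeparated f γ n ε R
  have hEG : (E : Set X) ⊆ G := (Finset.coe_subset.2 hER).trans hR'G
  refine ⟨R.image π, fun x hx => ?_, E, hEG, hE, ?_⟩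
  · rw [Set.mem_preimage, Finset.coe_image, hbij.image_eq]
    exact Set.mem_image_of_mem π hx
  · rw [Finset.card_image_of_injOn hbij.injOn]
    let close : X → Finset X := fun y => R.filter fun x =>
      ((Finset.univ.filter fun i => π x i ≠ π y i).card : ℝ) ≤ 5 * γ * n
    have hcover : R ⊆ E.biUnion close := by
      intro x hx
      obtain ⟨y, hy, h⟩ := hspan x hx
      refine Finset.mem_biUnion.2 ⟨y, hy, Finset.mem_filter.2 ⟨hx, ?_⟩⟩
      rcases h with rfl | h
      · simp only [ne_eq, not_true_eq_false, Finset.filter_false, Finset.card_empty,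
          Nat.cast_zero]
        positivity
      · exact card_hamming_le_of_mem_of_ncard_lt hW hn (hG x (hR'G hx)) (hG y (hEG hy)) h
    have hclose : ∀ y, ((close y).card : ℝ) ≤ Real.exp (n * κ) := by
      intro y
      have h := hκ (π y) ((close y).image π) fun w hw => by
        obtain ⟨x, hx, rfl⟩ := Finset.mem_image.1 hw
        exact (Finset.mem_filter.1 hx).2
      rwa [Finset.card_image_of_injOn
        (hbij.injOn.mono (Finset.coe_subset.2 (Finset.filter_subset _ _)))] at h
    calc (R.card : ℝ) ≤ ∑ y ∈ E, ((close y).card : ℝ) := by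
          exact_mod_cast (Finset.card_le_card hcover).trans Finset.card_biUnion_le
      _ ≤ E.card • Real.exp (n * κ) := Finset.sum_le_card_nsmul _ _ _ fun y _ => hclose y
      _ = _ := nsmul_eq_mul _ _

lemma exists_lt_entropyOfPartition {X : Type*} [MeasurableSpace X] {f : X → X} {φ : X → ℝ}
    {μ : Measure X} {c : ℝ} (h : c < freeEnergy f φ μ) :
    ∃ (k : ℕ) (ξ : X → Fin k), Measurable ξ ∧
      ((c - ∫ x, φ x ∂μ : ℝ) : EReal) < entropyOfPartition f μ ξ := by
  have h1 : ((c - ∫ x, φ x ∂μ : ℝ) : EReal) < entropy f μ := by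
    by_contra! hle
    refine h.not_ge ?_
    have := add_le_add_left hle ((∫ x, φ x ∂μ : ℝ) : EReal)
    rwa [← EReal.coe_add, sub_add_cancel] at this
  simp only [entropy, lt_iSup_iff] at h1
  obtain ⟨k, ξ, hξ, h⟩ := h1
  exact ⟨k, ξ, hξ, h⟩

variable [CompactSpace X] [MeasurableSpace X] [BorelSpace X]

lemma exists_le_lowerDeltaSPAt {f : X → X} {φ : X → ℝ} (hφ : Continuous φ)
    {μ : ProbabilityMeasure X} (hμ : Ergodic f (μ : Measure X)) {c : ℝ}
    (hc : c < freeEnergy f φ (μ : Measure X)) :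
    ∃ δ > 0, ∃ ε > 0, (c : EReal) ≤ lowerDeltaSPAt f φ μ δ ε := by
  set I := ∫ x, φ x ∂(μ : Measure X)
  obtain ⟨k, ξ, hξ, hent⟩ := exists_lt_entropyOfPartition hc
  obtain ⟨b, hb1, hb2⟩ := EReal.lt_iff_exists_real_btwn.1 hent
  have hb1 : c - I < b := by exact_mod_cast hb1
  -- The four losses of `η` are: `log 2`, the entropy carried outside `G n`, the size of Hamming
  -- balls, and the variation of `∫ φ`.
  set η := (b - (c - I)) / 4
  have hη : 0 < η := by simp only [η]; linarith
  obtain ⟨θ, hθ, hham⟩ := exists_hamming_card_le (Fin k) hη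
  -- Matches the Hamming radius `5γ`. The same `γ` serves as the separation frequency `δ` and as the
  -- bound on the measure of the complement of `W`.
  set γ := θ / 5
  have hγ : 0 < γ := by positivity
  obtain ⟨W, hWm, hWμ, ε, hε, hW⟩ := exists_separated_cells (μ : Measure X) hξ hγ
  refine ⟨γ, hγ, ε, hε, le_iInf₂ fun F hF => le_liminf_of_le (h := ?_)⟩
  let F' := F ∩ {ν : ProbabilityMeasure X | |∫ x, φ x ∂(ν : Measure X) - I| < η}
  have hF' : F' ∈ 𝓝 μ := inter_mem hF (setOf_abs_integral_sub_lt_mem_nhds hφ μ hη)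
  let G : ℕ → Set X := fun n =>
    empiricalSet f n F' ∩ {x | birkhoffAverage ℝ f (Wᶜ.indicator 1) n x < 2 * γ}
  have hGlim : Tendsto (fun n => (μ : Measure X).real (G n)ᶜ) atTop (𝓝 0) := by
    have hL2 : MemLp (Wᶜ.indicator (1 : X → ℝ)) 2 (μ : Measure X) :=
      (memLp_const (1 : ℝ)).indicator hWm.compl
    have h := (tendsto_measure_compl_empiricalSet hμ hF').add
      (tendsto_measure_birkhoffAverage_sub_integral hμ hL2 hγ)
    rw [add_zero] at h
    have h2 : Tendsto (fun n => (μ : Measure X) (G n)ᶜ) atTop (𝓝 0) := by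
      refine tendsto_of_tendsto_of_tendsto_of_le_of_le tendsto_const_nhds h (fun _ => bot_le)
        fun n => ?_
      rw [Set.compl_inter]
      refine (measure_union_le _ _).trans (add_le_add_right (measure_mono fun x hx => ?_) _)
      -- The mean of the indicator of `Wᶜ` is at most `γ`, so an average of at least `2γ` is a
      -- deviation of at least `γ`.
      have hx : 2 * γ ≤ birkhoffAverage ℝ f (Wᶜ.indicator 1) n x := not_lt.1 hx
      rw [integral_indicator_one hWm.compl]
      change γ ≤ |_ - _|
      exact le_trans (by linarith) (le_abs_self _)
    exact (ENNReal.toReal_zero ▸ ENNReal.tendsto_toReal ENNReal.zero_ne_top).comp h2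
  have hlog2 : ∀ᶠ n : ℕ in atTop, Real.log 2 ≤ n * η :=
    (tendsto_natCast_atTop_atTop.atTop_mul_const hη).eventually_ge_atTop _
  have hGlog : ∀ᶠ n in atTop, (μ : Measure X).real (G n)ᶜ * Real.log k < η :=
    (hGlim.mul_const _).eventually_lt_const (by simpa using hη)
  filter_upwards [hlog2, hGlog, hGlim.eventually_lt_const one_pos, eventually_lt_of_lt_liminf hb2,
    eventually_ne_atTop 0] with n h2 hGn hG1 hHn hn
  have hn' : (0 : ℝ) < n := by exact_mod_cast Nat.pos_of_ne_zero hn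
  obtain ⟨S, hGS, E, hEG, hE, hSE⟩ := exists_isDeltaSeparated_card_ge hγ hW hn (κ := η)
    (by
      have : 5 * γ = θ := by simp only [γ]; ring
      rw [this]
      exact hham n) (G := G n) fun x hx => hx.2
  have hS : S.Nonempty := by
    rw [Finset.nonempty_iff_ne_empty]
    rintro rfl
    have : G n = ∅ := by simpa using hGS
    simp [this] at hG1
  have hH : n * b < partitionEntropy (μ : Measure X) (iteratedPartition f ξ n) := by
    rw [mul_comm, ← lt_div_iff₀ hn']
    exact_mod_cast hHn
  have hent := partitionEntropy_le_of_subset_preimage (μ := (μ : Measure X)) hμ.measurable hξ n hS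
    hGS
  -- Nearly all the mass sits on names in `S`, so an entropy above `n b` forces `S` to be large.
  have hlogS : n * (b - 2 * η) ≤ Real.log S.card := by
    nlinarith
  have hSpos : (0 : ℝ) < S.card := by exact_mod_cast hS.card_pos
  rw [Real.le_log_iff_exp_le hSpos] at hlogS
  refine le_log_div hn ?_
  refine le_trans ?_ (le_iSup_of_le E (le_iSup₂_of_le
    (hEG.trans (Set.inter_subset_left.trans (empiricalSet_mono f n Set.inter_subset_left))) hE
    le_rfl))
  rw [← ENNReal.ofReal_sum_of_nonneg fun _ _ => (Real.exp_pos _).le]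
  refine ENNReal.ofReal_le_ofReal ?_
  have hsum : ∀ x ∈ E, Real.exp (n * (I - η)) ≤ Real.exp (birkhoffSum f φ n x) := fun x hx => by
    obtain ⟨ν, ⟨-, hν⟩, hνx⟩ := (hEG hx).1
    rw [birkhoffSum_eq_of_mem hφ hn hνx, Real.exp_le_exp]
    refine mul_le_mul_of_nonneg_left ?_ hn'.le
    have := (abs_lt.1 (Set.mem_ofPred_eq ▸ hν)).1
    linarith
  refine le_trans ?_ (Finset.card_nsmul_le_sum _ _ _ hsum)
  rw [nsmul_eq_mul]
  have h3 : Real.exp (n * (b - 3 * η)) ≤ E.card := by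
    have := hlogS.trans hSE
    rw [← div_le_iff₀ (Real.exp_pos _), ← Real.exp_sub] at this
    refine le_trans (le_of_eq ?_) this
    congr 1
    ring
  calc Real.exp (n * c) = Real.exp (n * (b - 3 * η)) * Real.exp (n * (I - η)) := by
        rw [← Real.exp_add]
        congr 1
        simp only [η]
        ring
    _ ≤ _ := mul_le_mul_of_nonneg_right h3 (Real.exp_pos _).le

end Lower

/-! ### Comparison of the pressures -/

section Comparison

variable {X : Type*} [MetricSpace X]

/-- As `δ * n > 0`, at least one time with distance above `ε` is counted, and it bounds the maximum
from below. -/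
lemma IsDeltaSeparated.isSeparated {f : X → X} {δ : ℝ} (hδ : 0 < δ) {n : ℕ} (hn : n ≠ 0) {ε : ℝ}
    {E : Set X} (hE : IsDeltaSeparated f δ n ε E) : IsSeparated f n ε E := by
  intro x hx y hy hxy
  have h1 : (0 : ℝ) < δ * n := mul_pos hδ (by exact_mod_cast Nat.pos_of_ne_zero hn)
  have h2 : 0 < Set.ncard {j : ℕ | j < n ∧ ε < dist (f^[j] x) (f^[j] y)} := by
    exact_mod_cast h1.trans_le (hE x hx y hy hxy)
  obtain ⟨j, hj, h⟩ := Set.nonempty_of_ncard_ne_zero h2.ne'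
  exact h.trans_le (le_ciSup (f := fun i : Fin n => dist (f^[i] x) (f^[i] y))
    (Set.finite_range _).bddAbove ⟨j, hj⟩)

variable [MeasurableSpace X]

lemma deltaSepSum_le_sepSum (f : X → X) (φ : X → ℝ) (F : Set (ProbabilityMeasure X)) {δ : ℝ}
    (hδ : 0 < δ) {n : ℕ} (hn : n ≠ 0) (ε : ℝ) : deltaSepSum f φ F δ n ε ≤ sepSum f φ F n ε :=
  iSup_mono fun _ => iSup_mono fun _ => iSup_mono' fun hE => ⟨hE.isSeparated hδ hn, le_rfl⟩

variable [OpensMeasurableSpace X] (f : X → X) (φ : X → ℝ) (ν : ProbabilityMeasure X)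

lemma upperDeltaSPAt_le_upperSPAt {δ : ℝ} (hδ : 0 < δ) (ε : ℝ) :
    upperDeltaSPAt f φ ν δ ε ≤ upperSPAt f φ ν ε :=
  iInf₂_mono fun F _ => limsup_le_limsup <| (eventually_ne_atTop 0).mono fun n hn =>
    log_div_mono n (deltaSepSum_le_sepSum f φ F hδ hn ε)

lemma lowerDeltaSPAt_le_lowerSPAt {δ : ℝ} (hδ : 0 < δ) (ε : ℝ) :
    lowerDeltaSPAt f φ ν δ ε ≤ lowerSPAt f φ ν ε :=
  iInf₂_mono fun F _ => liminf_le_liminf <| (eventually_ne_atTop 0).mono fun n hn =>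
    log_div_mono n (deltaSepSum_le_sepSum f φ F hδ hn ε)

lemma lowerSP_le_upperSP : lowerSP f φ ν ≤ upperSP f φ ν :=
  le_of_tendsto_of_tendsto' (tendsto_lowerSP f φ ν) (tendsto_upperSP f φ ν) fun _ =>
    iInf₂_mono fun _ _ => liminf_le_limsup

lemma upperDeltaSP_le_upperSP : upperDeltaSP f φ ν ≤ upperSP f φ ν := by
  obtain ⟨L, hL, hLim⟩ := tendsto_upperDeltaSP f φ ν
  refine le_of_tendsto_of_tendsto' hLim (tendsto_upperSP f φ ν) fun ε => ?_
  exact le_of_tendsto (hL ε) (eventually_mem_nhdsWithin.mono fun δ hδ =>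
    upperDeltaSPAt_le_upperSPAt f φ ν hδ ε)

lemma lowerDeltaSP_le_lowerSP : lowerDeltaSP f φ ν ≤ lowerSP f φ ν := by
  obtain ⟨L, hL, hLim⟩ := tendsto_lowerDeltaSP f φ ν
  refine le_of_tendsto_of_tendsto' hLim (tendsto_lowerSP f φ ν) fun ε => ?_
  exact le_of_tendsto (hL ε) (eventually_mem_nhdsWithin.mono fun δ hδ =>
    lowerDeltaSPAt_le_lowerSPAt f φ ν hδ ε)

lemma lowerDeltaSP_le_upperDeltaSP : lowerDeltaSP f φ ν ≤ upperDeltaSP f φ ν := by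
  obtain ⟨L, hL, hLim⟩ := tendsto_lowerDeltaSP f φ ν
  obtain ⟨U, hU, hUlim⟩ := tendsto_upperDeltaSP f φ ν
  exact le_of_tendsto_of_tendsto' hLim hUlim fun ε =>
    le_of_tendsto_of_tendsto' (hL ε) (hU ε) fun δ => iInf₂_mono fun _ _ => liminf_le_limsup

variable {f φ ν}

/-- Decreasing `δ` or `ε` only increases the quantity, so a bound at one pair passes to the iterated
limit. -/
lemma le_lowerDeltaSP_of_le {δ₀ ε₀ : ℝ} (hδ : 0 < δ₀) (hε : 0 < ε₀) {c : EReal}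
    (h : c ≤ lowerDeltaSPAt f φ ν δ₀ ε₀) : c ≤ lowerDeltaSP f φ ν := by
  obtain ⟨L, hL, hLim⟩ := tendsto_lowerDeltaSP f φ ν
  refine ge_of_tendsto hLim ?_
  filter_upwards [nhdsWithin_le_nhds (Iic_mem_nhds hε)] with ε hε'
  refine ge_of_tendsto (hL ε) ?_
  filter_upwards [nhdsWithin_le_nhds (Iic_mem_nhds hδ)] with δ hδ'
  exact h.trans (lowerDeltaSPAt_anti f φ ν hδ' hε')

end Comparison

/-! ### The two bounds in the limit -/

section Bounds

variable {X : Type*} [MetricSpace X] [CompactSpace X] [MeasurableSpace X] [BorelSpace X]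
  {f : X → X} {φ : X → ℝ} {μ : ProbabilityMeasure X}

theorem upperSP_le_freeEnergy (hf : Continuous f) (hφ : Continuous φ)
    (hμ : MeasurePreserving f (μ : Measure X) (μ : Measure X)) :
    upperSP f φ μ ≤ freeEnergy f φ (μ : Measure X) :=
  le_of_tendsto (tendsto_upperSP f φ μ) (eventually_mem_nhdsWithin.mono fun _ hε =>
    upperSPAt_le_freeEnergy hf hφ hμ hε)

theorem freeEnergy_le_lowerDeltaSP (hφ : Continuous φ) (hμ : Ergodic f (μ : Measure X)) :
    freeEnergy f φ (μ : Measure X) ≤ lowerDeltaSP f φ μ := by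
  refine EReal.ge_of_forall_gt_iff_ge.1 fun c hc => ?_
  obtain ⟨δ, hδ, ε, hε, h⟩ := exists_le_lowerDeltaSPAt hφ hμ hc
  exact le_lowerDeltaSP_of_le hδ hε h

end Bounds

end SepPressure

theorem theorem4p6 {X : Type*} [MetricSpace X] [CompactSpace X] [MeasurableSpace X] [BorelSpace X]
    (f : X → X) (hf : Continuous f) (φ : X → ℝ) (hφ : Continuous φ) :
    (∀ μ : ProbabilityMeasure X, Ergodic f (μ : Measure X) →
      (SepPressure.lowerSP f φ μ = SepPressure.freeEnergy f φ (μ : Measure X) ∧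
        SepPressure.upperSP f φ μ = SepPressure.freeEnergy f φ (μ : Measure X)) ∧
      (SepPressure.lowerDeltaSP f φ μ = SepPressure.freeEnergy f φ (μ : Measure X) ∧
        SepPressure.upperDeltaSP f φ μ = SepPressure.freeEnergy f φ (μ : Measure X))) ∧
    (∀ μ : ProbabilityMeasure X, MeasurePreserving f (μ : Measure X) (μ : Measure X) →
      SepPressure.upperSP f φ μ ≤ SepPressure.freeEnergy f φ (μ : Measure X) ∧
      SepPressure.upperDeltaSP f φ μ ≤ SepPressure.freeEnergy f φ (μ : Measure X)) := by
  have upper : ∀ μ : ProbabilityMeasure X, MeasurePreserving f (μ : Measure X) (μ : Measure X) →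
      SepPressure.upperSP f φ μ ≤ SepPressure.freeEnergy f φ (μ : Measure X) :=
    fun μ hμ => SepPressure.upperSP_le_freeEnergy hf hφ hμ
  refine ⟨fun μ hμ => ?_, fun μ hμ =>
    ⟨upper μ hμ, (SepPressure.upperDeltaSP_le_upperSP f φ μ).trans (upper μ hμ)⟩⟩
  have hU := upper μ hμ.toMeasurePreserving
  have hL := SepPressure.freeEnergy_le_lowerDeltaSP hφ hμ
  have h1 := SepPressure.lowerDeltaSP_le_lowerSP f φ μ
  have h2 := SepPressure.lowerSP_le_upperSP f φ μ
  have h3 := SepPressure.lowerDeltaSP_le_upperDeltaSP f φ μ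
  have h4 := SepPressure.upperDeltaSP_le_upperSP f φ μ
  exact ⟨⟨le_antisymm (h2.trans hU) (hL.trans h1),
    le_antisymm hU ((hL.trans h1).trans h2)⟩,
    le_antisymm ((h3.trans h4).trans hU) hL, le_antisymm (h4.trans hU) (hL.trans h3)⟩
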